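/- Let $\{X(s)\}_{s\in[0,1]}$ be a real-valued centered Gaussian process for which there is $\alpha\in(1/2,1]$ such that, with probability $1$, there is a finite (random) constant $C$ with $|X(s_1)-X(s_2)|\le C|s_1-s_2|^{\alpha}$ for all $s_1,s_2\in[0,1]$. Let $\Phi:\mathbb{R}\to\mathbb{R}$ be continuously differentiable with $|\Phi(x)|+|\Phi'(x)|\le c(1+|x|)^{L}$ for all $x\in\mathbb{R}$, where $c,L>0$ are constants. Let $\{W(s)\}_{s\in[0,1]}$ be a standard Brownian motion, defined on the same probability space and independent of the process $X$. Then the Itô integral process $$Z(t)=\int_0^t\Phi(X(s))\,dW(s),\qquad t\in[0,1],$$ (taken with respect to the filtration generated by $X$ and $W$) is well defined, and $\{Z(t)\}_{t\in[0,1]}$ has a modification whose trajectories, with probability $1$, belong to the Hölder space $C^{\gamma}([0,1])$ simultaneously for all $\gamma\in[0,1/2)$. Here, for $\gamma\in[0,1]$, $C^{\gamma}([0,1])$ is the space of the continuous functions $u:[0,1]\to\mathbb{R}$ such that $\sup_{0\le t_1<t_2\le 1}|u(t_1)-u(t_2)|/|t_1-t_2|^{\gamma}<\infty$. -/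

import Mathlib

open MeasureTheory ProbabilityTheory Filter Topology
open scoped NNReal ENNReal

noncomputable section

/-- A standard Brownian motion indexed by the time interval `[0,1]`. -/
structure IsStandardBrownianMotion {Ω : Type*} {mΩ : MeasurableSpace Ω}
    (W : Set.Icc (0 : ℝ) 1 → Ω → ℝ) (P : Measure Ω) : Prop where
  measurable : ∀ t, Measurable (W t)
  start_zero : ∀ᵐ ω ∂P, W 0 ω = 0
  indep_increments : HasIndepIncrements W P
  gaussian_increments : ∀ s t, s ≤ t →
    HasLaw (fun ω ↦ W t ω - W s ω) (gaussianReal 0 (Real.toNNReal ((t : ℝ) - (s : ℝ)))) P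
  continuous_paths : ∀ᵐ ω ∂P, Continuous fun t ↦ W t ω

/-- The filtration `𝓕 t = σ(X s, W s ; s ≤ t)` generated by two processes. -/
def jointFiltration {Ω : Type*} {mΩ : MeasurableSpace Ω} (X W : Set.Icc (0 : ℝ) 1 → Ω → ℝ)
    (hX : ∀ t, Measurable (X t)) (hW : ∀ t, Measurable (W t)) :
    Filtration (Set.Icc (0 : ℝ) 1) mΩ :=
  Filtration.natural (fun t ω ↦ (X t ω, W t ω))
    (fun t ↦ ((hX t).prodMk (hW t)).stronglyMeasurable)

/-- A simple (elementary predictable) process: a finite partition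
`time 0 ≤ time 1 ≤ … ≤ time n` in `[0,1]` and, on each interval `(time i, time (i+1)]`, a
square-integrable random value known at the left end point `time i`. -/
structure SimpleProcess {Ω : Type*} {mΩ : MeasurableSpace Ω}
    (𝓕 : Filtration (Set.Icc (0 : ℝ) 1) mΩ) (P : Measure Ω) where
  n : ℕ
  time : Fin (n + 1) → Set.Icc (0 : ℝ) 1
  time_mono : Monotone time
  coeff : Fin n → Ω → ℝ
  coeff_measurable : ∀ i, Measurable[𝓕 (time i.castSucc)] (coeff i)
  coeff_memLp : ∀ i, MemLp (coeff i) 2 P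

/-- The value of a simple process at time `s`. -/
def SimpleProcess.value {Ω : Type*} {mΩ : MeasurableSpace Ω}
    {𝓕 : Filtration (Set.Icc (0 : ℝ) 1) mΩ} {P : Measure Ω} (V : SimpleProcess 𝓕 P)
    (s : Set.Icc (0 : ℝ) 1) (ω : Ω) : ℝ :=
  ∑ i : Fin V.n,
    (Set.Ioc (V.time i.castSucc) (V.time i.succ)).indicator (fun _ ↦ V.coeff i ω) s

/-- The elementary stochastic integral `∫₀ᵗ V dW` of a simple process. -/
def SimpleProcess.integral {Ω : Type*} {mΩ : MeasurableSpace Ω}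
    {𝓕 : Filtration (Set.Icc (0 : ℝ) 1) mΩ} {P : Measure Ω} (V : SimpleProcess 𝓕 P)
    (W : Set.Icc (0 : ℝ) 1 → Ω → ℝ) (t : Set.Icc (0 : ℝ) 1) (ω : Ω) : ℝ :=
  ∑ i : Fin V.n,
    V.coeff i ω * (W (min (V.time i.succ) t) ω - W (min (V.time i.castSucc) t) ω)

/-- `Z` is (a version of) the Itô integral process `Z t = ∫₀ᵗ H s dW s`, `t ∈ [0,1]`, of the
integrand `H ∈ L²([0,1] × Ω)`: there are simple processes converging to `H` in `L²([0,1] × Ω)`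
whose elementary integrals up to time `t` converge to `Z t` in `L²(Ω)`, for every `t`. -/
structure IsItoIntegral {Ω : Type*} {mΩ : MeasurableSpace Ω}
    (𝓕 : Filtration (Set.Icc (0 : ℝ) 1) mΩ) (P : Measure Ω)
    (W H Z : Set.Icc (0 : ℝ) 1 → Ω → ℝ) : Prop where
  integrand_memLp : MemLp (Function.uncurry H) 2 (volume.prod P)
  measurable : ∀ t, Measurable (Z t)
  approx : ∃ V : ℕ → SimpleProcess 𝓕 P,
    Tendsto (fun k ↦ eLpNorm (fun p : Set.Icc (0 : ℝ) 1 × Ω ↦ (V k).value p.1 p.2 - H p.1 p.2) 2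
      (volume.prod P)) atTop (𝓝 0) ∧
    ∀ t, Tendsto (fun k ↦ eLpNorm (fun ω ↦ (V k).integral W t ω - Z t ω) 2 P) atTop (𝓝 0)

/-- `Y` is a stochastic process which is a modification of `Z`. -/
def IsModification {Ω : Type*} {mΩ : MeasurableSpace Ω} (P : Measure Ω)
    (Y Z : Set.Icc (0 : ℝ) 1 → Ω → ℝ) : Prop :=
  ∀ t, Measurable (Y t) ∧ Y t =ᵐ[P] Z t

/-- The Hölder space `C^γ([0,1])`: the continuous functions `u` for which the supremum of the
difference quotients `|u t₁ - u t₂| / |t₁ - t₂| ^ γ`, `t₁ < t₂`, is finite. -/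
def holderSpace (γ : ℝ) : Set (Set.Icc (0 : ℝ) 1 → ℝ) :=
  {u | Continuous u ∧ BddAbove {q : ℝ | ∃ t₁ t₂ : Set.Icc (0 : ℝ) 1, t₁ < t₂ ∧
    q = |u t₁ - u t₂| / |(t₁ : ℝ) - (t₂ : ℝ)| ^ γ}}

end

/-! Since `X` is independent of `W`, the integral behaves, given `X`, like a Wiener integral of a
deterministic function: `Z t - Z s` is centered Gaussian with variance `∫ₛᵗ Φ(X r)² dr`. Hence `E|Z
t - Z s|^(2p) ≤ m · M · |t - s|^p` for every `p ≥ 1`, where `m` is the `2p`-th moment of a standard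
Gaussian and `M` bounds `E|Φ(X r)|^(2p)` uniformly in `r`. Kolmogorov's criterion then gives every
exponent below `1/2 - 1/(2p)`; letting `p` run through the integers covers all `γ < 1/2` outside a
single null set (`exists_modification_holder`).

The bound `M` is finite because the variances of `X` are bounded, by continuity of its paths, and
`Φ` grows polynomially (`exists_hasLaw_gaussianReal_le`, `exists_lintegral_comp_pow_le`). The moment
inequality is proved for left-endpoint sums, where conditioning on `X` is Fubini for an independent
pair (`IsStandardBrownianMotion.lintegral_sum_mul_increments_pow_le`), and passes to `Z` by Fatou
(`IsItoIntegral.lintegral_sub_pow_le`).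

Existence of `Z`, and the fact that any version is the limit of these same sums, come from the Itô
isometry: increments of `W` are independent of the joint past of `X` and `W`, and the left-endpoint
step processes converge to `Φ(X)` in `L²` by path continuity and a uniform fourth moment. -/

/-! ### Deterministic dyadic chaining -/

/-- Chaining along dyadic levels: geometric control of the increments of neighbours at every level
controls all increments of points at distance at most `2 ^ d` at level `n`. -/
lemma abs_sub_le_of_dyadic_increments {F : ℕ → ℕ → ℝ} {K r : ℝ} (hK : 0 ≤ K) (hr0 : 0 < r)
    (hr1 : r < 1) (hF : ∀ n k, F (n + 1) (2 * k) = F n k)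
    (hinc : ∀ n k, |F n (k + 1) - F n k| ≤ K * r ^ n) (d : ℕ) :
    ∀ n i j : ℕ, d ≤ n → i ≤ j → j ≤ i + 2 ^ d →
      |F n j - F n i| ≤ 2 * K * (r ^ (n - d) - r ^ (n + 1)) / (1 - r) := by
  have h1r : 0 < 1 - r := by linarith
  -- The right-hand side is the geometric sum `2K (r^(n-d) + … + r^n)`: at each level the chain
  -- makes at most one move at either end.
  induction d with
  | zero =>
    intro n i j _ hij hji
    have e : 2 * K * (r ^ (n - 0) - r ^ (n + 1)) / (1 - r) = 2 * (K * r ^ n) := by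
      field_simp
      simp only [Nat.sub_zero]
      ring
    have hp : 0 ≤ K * r ^ n := by positivity
    rw [e]
    obtain rfl | rfl : j = i ∨ j = i + 1 := by simp at hji; omega
    · simpa using hp
    · linarith [hinc n i]
  | succ d ih =>
    intro n i j hdn hij hji
    obtain ⟨n, rfl⟩ : ∃ m, n = m + 1 := ⟨n - 1, by omega⟩
    have hp : 0 ≤ K * r ^ (n + 1) := by positivity
    have hup : ∀ i, ∃ i', i ≤ 2 * i' ∧ 2 * i' ≤ i + 1 ∧
        |F (n + 1) i - F n i'| ≤ K * r ^ (n + 1) := by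
      intro i
      obtain ⟨m, rfl | rfl⟩ := i.even_or_odd'
      · exact ⟨m, by omega, by omega, by rw [hF]; simpa using hp⟩
      · refine ⟨m + 1, by omega, by omega, ?_⟩
        rw [← hF n (m + 1), abs_sub_comm]
        exact hinc (n + 1) (2 * m + 1)
    have hdown : ∀ i, ∃ i', 2 * i' ≤ i ∧ i ≤ 2 * i' + 1 ∧
        |F (n + 1) i - F n i'| ≤ K * r ^ (n + 1) := by
      intro i
      obtain ⟨m, rfl | rfl⟩ := i.even_or_odd'
      · exact ⟨m, by omega, by omega, by rw [hF]; simpa using hp⟩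
      · refine ⟨m, by omega, by omega, ?_⟩
        rw [← hF n m]
        exact hinc (n + 1) (2 * m)
    obtain ⟨i', hi1, hi2, hi3⟩ := hup i
    obtain ⟨j', hj1, hj2, hj3⟩ := hdown j
    have hnd : n + 1 - (d + 1) = n - d := by omega
    have e : 2 * K * (r ^ (n + 1 - (d + 1)) - r ^ (n + 1 + 1)) / (1 - r) =
        2 * K * (r ^ (n - d) - r ^ (n + 1)) / (1 - r) + 2 * (K * r ^ (n + 1)) := by
      rw [hnd]
      field_simp
      ring
    rw [e]
    -- Both ends are rounded inwards to even indices. They can cross only when `i = j` is odd.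
    by_cases hle : i' ≤ j'
    · have h := ih n i' j' (by omega) hle (by rw [pow_succ] at hji; omega)
      calc |F (n + 1) j - F (n + 1) i|
          = |(F n j' - F n i') + (F (n + 1) j - F n j') - (F (n + 1) i - F n i')| := by
            congr 1; ring
        _ ≤ |(F n j' - F n i') + (F (n + 1) j - F n j')| + |F (n + 1) i - F n i'| := abs_sub _ _
        _ ≤ |F n j' - F n i'| + |F (n + 1) j - F n j'| + |F (n + 1) i - F n i'| := by
            gcongr; exact abs_add_le _ _
        _ ≤ _ := by linarith
    · have : i = j := by omega
      subst this
      have : r ^ (n + 1) ≤ r ^ (n - d) :=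
        pow_le_pow_of_le_one hr0.le hr1.le (by omega)
      have : 0 ≤ 2 * K * (r ^ (n - d) - r ^ (n + 1)) / (1 - r) := by
        apply div_nonneg _ h1r.le
        apply mul_nonneg (by positivity)
        linarith
      rw [sub_self, abs_zero]
      positivity

/-- Hölder estimate on the dyadic points of level `n`. -/
lemma abs_sub_le_rpow_of_dyadic_increments {F : ℕ → ℕ → ℝ} {K γ : ℝ} (hK : 0 ≤ K) (hγ : 0 < γ)
    (hF : ∀ n k, F (n + 1) (2 * k) = F n k)
    (hinc : ∀ n k, |F n (k + 1) - F n k| ≤ K * ((2 : ℝ) ^ (-γ)) ^ n) {n i j : ℕ}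
    (hij : i ≤ j) (hj : j ≤ i + 2 ^ n) :
    |F n j - F n i| ≤
      2 * K / (1 - (2 : ℝ) ^ (-γ)) * 2 ^ γ * (((j : ℝ) - i) / 2 ^ n) ^ γ := by
  have hr0 : (0 : ℝ) < 2 ^ (-γ) := by positivity
  have hr1 : (2 : ℝ) ^ (-γ) < 1 := Real.rpow_lt_one_of_one_lt_of_neg (by norm_num) (by linarith)
  have h1r : 0 < 1 - (2 : ℝ) ^ (-γ) := by linarith
  rcases hij.eq_or_lt with rfl | hlt
  · simp [hγ.ne']
  classical
  have hex : ∃ d, j ≤ i + 2 ^ d := ⟨n, hj⟩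
  -- Minimality of `d` makes `2^d` comparable to `j - i`, which turns the bound `r^(n-d)` into the
  -- `γ`-th power of the distance.
  set d := Nat.find hex with hd
  have hd1 : j ≤ i + 2 ^ d := Nat.find_spec hex
  have hdn : d ≤ n := Nat.find_min' hex hj
  have hd2 : (2 : ℝ) ^ d ≤ 2 * ((j : ℝ) - i) := by
    rcases Nat.eq_zero_or_pos d with h0 | h0
    · rw [h0]
      have : (i : ℝ) + 1 ≤ j := by exact_mod_cast hlt
      norm_num
      linarith
    · have h := Nat.find_min hex (m := d - 1) (by omega)
      obtain ⟨e, he⟩ : ∃ e, d = e + 1 := ⟨d - 1, by omega⟩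
      rw [he] at h ⊢
      simp only [Nat.add_sub_cancel, not_le] at h
      have : (i : ℝ) + 2 ^ e < j := by exact_mod_cast h
      rw [pow_succ]
      linarith
  refine (abs_sub_le_of_dyadic_increments hK hr0 hr1 hF hinc d n i j hdn hij hd1).trans ?_
  have hpow : ((2 : ℝ) ^ (-γ)) ^ (n - d) ≤ 2 ^ γ * (((j : ℝ) - i) / 2 ^ n) ^ γ := by
    have hji : (0 : ℝ) ≤ (j : ℝ) - i := by
      have : (i : ℝ) ≤ j := by exact_mod_cast hij
      linarith
    rw [← Real.mul_rpow (by norm_num) (by positivity), ← Real.rpow_natCast, ← Real.rpow_mul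
      (by norm_num), show -γ * ((n - d : ℕ) : ℝ) = -((n - d : ℕ) : ℝ) * γ by ring,
      Real.rpow_mul (by norm_num)]
    refine Real.rpow_le_rpow (by positivity) ?_ hγ.le
    rw [Real.rpow_neg (by norm_num), Real.rpow_natCast, pow_sub₀ _ (by norm_num) hdn]
    rw [mul_inv, inv_inv, ← div_eq_inv_mul, ← mul_div_assoc]
    gcongr
  calc 2 * K * (((2 : ℝ) ^ (-γ)) ^ (n - d) - (2 ^ (-γ)) ^ (n + 1)) / (1 - 2 ^ (-γ))
      ≤ 2 * K * (((2 : ℝ) ^ (-γ)) ^ (n - d)) / (1 - 2 ^ (-γ)) := by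
        gcongr
        have : 0 < ((2 : ℝ) ^ (-γ)) ^ (n + 1) := by positivity
        linarith
    _ = 2 * K / (1 - 2 ^ (-γ)) * ((2 : ℝ) ^ (-γ)) ^ (n - d) := by ring
    _ ≤ 2 * K / (1 - 2 ^ (-γ)) * (2 ^ γ * (((j : ℝ) - i) / 2 ^ n) ^ γ) := by gcongr
    _ = _ := by ring

/-- The dyadic point `k / 2 ^ n` of the unit interval, with the convention that it is `1`
for `k ≥ 2 ^ n`. -/
noncomputable def dyadicPoint (n k : ℕ) : Set.Icc (0 : ℝ) 1 :=
  Set.projIcc 0 1 zero_le_one ((k : ℝ) / 2 ^ n)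

lemma dyadicPoint_succ_two_mul (n k : ℕ) : dyadicPoint (n + 1) (2 * k) = dyadicPoint n k := by
  unfold dyadicPoint
  congr 1
  push_cast
  rw [pow_succ]
  field_simp

lemma dyadicPoint_of_le {n k : ℕ} (h : 2 ^ n ≤ k) : dyadicPoint n k = 1 := by
  have h' : (2 : ℝ) ^ n ≤ k := by exact_mod_cast h
  exact Set.projIcc_of_right_le _ (by rw [le_div_iff₀ (by positivity)]; linarith)

lemma coe_dyadicPoint {n k : ℕ} (h : k ≤ 2 ^ n) : (dyadicPoint n k : ℝ) = k / 2 ^ n := by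
  have h' : (k : ℝ) ≤ 2 ^ n := by exact_mod_cast h
  unfold dyadicPoint
  rw [Set.projIcc_of_mem zero_le_one ⟨by positivity, by rw [div_le_one (by positivity)]; exact h'⟩]

lemma abs_dyadicPoint_sub_le (n k : ℕ) :
    |(dyadicPoint n (k + 1) : ℝ) - dyadicPoint n k| ≤ (1 / 2) ^ n := by
  have h := Set.abs_projIcc_sub_projIcc (a := (0 : ℝ)) (b := 1) zero_le_one
    (c := ((k + 1 : ℕ) : ℝ) / 2 ^ n) (d := (k : ℝ) / 2 ^ n)
  refine h.trans (le_of_eq ?_)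
  rw [← sub_div]
  push_cast
  rw [add_sub_cancel_left, abs_of_nonneg (by positivity), one_div, one_div, inv_pow]

/-! ### Kolmogorov's continuity criterion -/

section Kolmogorov

variable {Ω : Type*} {mΩ : MeasurableSpace Ω} {P : Measure Ω} {Z : Set.Icc (0 : ℝ) 1 → Ω → ℝ}

/-- The sum over all dyadic increments of `(2^(γn) |increment|)^(2p)` has finite expectation: level
`n` has `2^n` terms, each of mean at most `M · 2^(2pγn) · 2^(-pn)`, so the hypothesis on `γ` gives a
convergent geometric series. Almost surely the sum is finite and bounds each term. -/
lemma ae_exists_dyadic_increments_le (hZ : ∀ t, Measurable (Z t)) {p : ℕ} (hp : 0 < p)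
    {M : ℝ≥0∞} (hM : M ≠ ∞)
    (hmom : ∀ s t : Set.Icc (0 : ℝ) 1, ∫⁻ ω, ‖Z t ω - Z s ω‖ₑ ^ (2 * p) ∂P ≤
      M * ENNReal.ofReal |(t : ℝ) - s| ^ p) {γ : ℝ} (hγ : 1 + 2 * p * γ < p) :
    ∀ᵐ ω ∂P, ∃ K : ℝ, 0 ≤ K ∧ ∀ n k : ℕ,
      |Z (dyadicPoint n (k + 1)) ω - Z (dyadicPoint n k) ω| ≤ K * ((2 : ℝ) ^ (-γ)) ^ n := by
  set a : ℝ := 2 ^ γ with ha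
  have ha0 : 0 < a := by positivity
  set D : ℕ → ℕ → Ω → ℝ := fun n k ω ↦
    Z (dyadicPoint n (k + 1)) ω - Z (dyadicPoint n k) ω with hD
  have hDm : ∀ n k, Measurable (D n k) := fun n k ↦ (hZ _).sub (hZ _)
  set G : Ω → ℝ≥0∞ := fun ω ↦ ∑' n : ℕ, ∑ k ∈ Finset.range (2 ^ n),
    (ENNReal.ofReal a ^ n * ‖D n k ω‖ₑ) ^ (2 * p) with hG
  have hmeas : ∀ n k, Measurable fun ω ↦ (ENNReal.ofReal a ^ n * ‖D n k ω‖ₑ) ^ (2 * p) :=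
    fun n k ↦ ((hDm n k).enorm.const_mul _).pow_const _
  have hGm : Measurable G :=
    Measurable.tsum fun n ↦ Finset.measurable_sum _ fun k _ ↦ hmeas n k
  set b : ℝ := 2 * a ^ (2 * p) * (1 / 2) ^ p with hb
  have hb1 : b < 1 := by
    have : b = 2 ^ (1 + 2 * p * γ - p) := by
      rw [hb, ha, Real.rpow_sub (by norm_num), Real.rpow_add (by norm_num), Real.rpow_one,
        mul_comm _ γ, Real.rpow_mul (by norm_num), Real.rpow_natCast,
        show ((2 : ℝ) * p) = ((2 * p : ℕ) : ℝ) by push_cast; ring, Real.rpow_natCast, one_div,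
        inv_pow, div_eq_mul_inv]
    rw [this]
    exact Real.rpow_lt_one_of_one_lt_of_neg (by norm_num) (by linarith)
  have hint : ∫⁻ ω, G ω ∂P ≤ M * (1 - ENNReal.ofReal b)⁻¹ := by
    rw [hG, lintegral_tsum fun n ↦ (Finset.measurable_sum _ fun k _ ↦ hmeas n k).aemeasurable,
      ← ENNReal.tsum_geometric, ← ENNReal.tsum_mul_left]
    refine ENNReal.tsum_le_tsum fun n ↦ ?_
    rw [lintegral_finsetSum _ fun k _ ↦ hmeas n k]
    calc ∑ k ∈ Finset.range (2 ^ n), ∫⁻ ω, (ENNReal.ofReal a ^ n * ‖D n k ω‖ₑ) ^ (2 * p) ∂P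
        ≤ ∑ k ∈ Finset.range (2 ^ n), (ENNReal.ofReal a ^ n) ^ (2 * p) *
            (M * ENNReal.ofReal ((1 / 2) ^ n) ^ p) := by
          refine Finset.sum_le_sum fun k _ ↦ ?_
          simp_rw [mul_pow]
          rw [lintegral_const_mul _ ((hDm n k).enorm.pow_const _)]
          gcongr
          refine (hmom _ _).trans ?_
          gcongr
          exact abs_dyadicPoint_sub_le n k
      _ = M * ENNReal.ofReal b ^ n := by
          rw [Finset.sum_const, Finset.card_range, nsmul_eq_mul, hb,
            ENNReal.ofReal_mul (by positivity), ENNReal.ofReal_mul (by positivity),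
            ENNReal.ofReal_pow (by positivity), ENNReal.ofReal_pow (by positivity),
            ENNReal.ofReal_pow (by positivity)]
          push_cast
          rw [ENNReal.ofReal_ofNat, mul_pow, mul_pow]
          ring
  have hfin : ∀ᵐ ω ∂P, G ω < ∞ := by
    refine ae_lt_top hGm (ne_top_of_le_ne_top (ENNReal.mul_ne_top hM ?_) hint)
    rw [ENNReal.inv_ne_top]
    have : ENNReal.ofReal b < 1 := by
      rw [← ENNReal.ofReal_one]
      exact (ENNReal.ofReal_lt_ofReal_iff one_pos).2 hb1
    exact (tsub_pos_of_lt this).ne'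
  filter_upwards [hfin] with ω hω
  -- From `x^(2p) ≤ G` one gets `x ≤ max 1 G`, so `G + 1` avoids taking a root.
  refine ⟨(G ω).toReal + 1, by positivity, fun n k ↦ ?_⟩
  by_cases hk : k < 2 ^ n
  · set x : ℝ := a ^ n * |D n k ω| with hx
    have hx0 : 0 ≤ x := by positivity
    have h1 : ENNReal.ofReal (x ^ (2 * p)) ≤ G ω := by
      have h2 : (ENNReal.ofReal a ^ n * ‖D n k ω‖ₑ) ^ (2 * p) ≤ G ω :=
        (Finset.single_le_sum (f := fun k ↦ (ENNReal.ofReal a ^ n * ‖D n k ω‖ₑ) ^ (2 * p))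
          (fun _ _ ↦ zero_le) (Finset.mem_range.2 hk)).trans
          (ENNReal.le_tsum (f := fun n ↦ ∑ k ∈ Finset.range (2 ^ n),
            (ENNReal.ofReal a ^ n * ‖D n k ω‖ₑ) ^ (2 * p)) n)
      refine le_of_eq_of_le ?_ h2
      rw [ENNReal.ofReal_pow hx0, hx, ENNReal.ofReal_mul (by positivity),
        ENNReal.ofReal_pow ha0.le, Real.enorm_eq_ofReal_abs]
    have h3 : x ^ (2 * p) ≤ (G ω).toReal := (ENNReal.ofReal_le_iff_le_toReal hω.ne).1 h1
    have h4 : x ≤ (G ω).toReal + 1 := by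
      rcases le_total x 1 with h | h
      · have : 0 ≤ (G ω).toReal := ENNReal.toReal_nonneg
        linarith
      · have := le_self_pow₀ h (n := 2 * p) (by omega)
        linarith
    have h5 : ((2 : ℝ) ^ (-γ)) ^ n = (a ^ n)⁻¹ := by
      rw [Real.rpow_neg (by norm_num), inv_pow]
    rw [h5, ← div_eq_mul_inv, le_div_iff₀ (by positivity), mul_comm]
    exact h4
  · rw [dyadicPoint_of_le (not_lt.1 hk), dyadicPoint_of_le (by omega), sub_self, abs_zero]
    positivity

/-- The left dyadic neighbour at level `n` of a point of the unit interval. -/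
noncomputable def dyadicFloor (n : ℕ) (t : Set.Icc (0 : ℝ) 1) : ℕ := ⌊(t : ℝ) * 2 ^ n⌋₊

lemma dyadicFloor_le (n : ℕ) (t : Set.Icc (0 : ℝ) 1) : dyadicFloor n t ≤ 2 ^ n := by
  refine Nat.floor_le_of_le ?_
  push_cast
  exact mul_le_of_le_one_left (by positivity) t.2.2

lemma dyadicFloor_mono (n : ℕ) : Monotone (dyadicFloor n) := fun s t hst ↦ by
  refine Nat.floor_le_floor ?_
  have : (s : ℝ) ≤ t := hst
  gcongr

lemma tendsto_dyadicFloor (t : Set.Icc (0 : ℝ) 1) :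
    Tendsto (fun n ↦ (dyadicFloor n t : ℝ) / 2 ^ n) atTop (𝓝 t) := by
  have h := (tendsto_nat_floor_mul_div_atTop (R := ℝ) (a := t) t.2.1).comp
    (tendsto_pow_atTop_atTop_of_one_lt (r := (2 : ℝ)) one_lt_two)
  exact h

lemma abs_coe_dyadicFloor_sub_le (n : ℕ) (t : Set.Icc (0 : ℝ) 1) :
    |(t : ℝ) - dyadicPoint n (dyadicFloor n t)| ≤ (1 / 2) ^ n := by
  rw [coe_dyadicPoint (dyadicFloor_le n t), one_div, inv_pow]
  have h1 := Nat.floor_le (mul_nonneg t.2.1 (by positivity : (0 : ℝ) ≤ 2 ^ n))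
  have h2 := (Nat.lt_floor_add_one ((t : ℝ) * 2 ^ n)).le
  change ((dyadicFloor n t : ℕ) : ℝ) ≤ _ at h1
  change _ ≤ ((dyadicFloor n t : ℕ) : ℝ) + 1 at h2
  have e : (t : ℝ) - dyadicFloor n t / 2 ^ n = ((t : ℝ) * 2 ^ n - dyadicFloor n t) / 2 ^ n := by
    field_simp
  rw [e, abs_of_nonneg (div_nonneg (by linarith) (by positivity)), div_le_iff₀ (by positivity),
    inv_mul_cancel₀ (by positivity)]
  linarith

/-- The candidate for the continuous modification: limits along dyadic points. -/
noncomputable def dyadicLimit (Z : Set.Icc (0 : ℝ) 1 → Ω → ℝ) (t : Set.Icc (0 : ℝ) 1) (ω : Ω) : ℝ :=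
  limUnder atTop fun n ↦ Z (dyadicPoint n (dyadicFloor n t)) ω

lemma measurable_dyadicLimit (hZ : ∀ t, Measurable (Z t)) (t : Set.Icc (0 : ℝ) 1) :
    Measurable (dyadicLimit Z t) :=
  (StronglyMeasurable.limUnder fun _ ↦ (hZ _).stronglyMeasurable).measurable

/-- A path whose dyadic increments are controlled converges along dyadic approximations. -/
lemma tendsto_dyadicLimit {ω : Ω} {K γ : ℝ} (hK : 0 ≤ K) (hγ : 0 < γ)
    (h : ∀ n k : ℕ, |Z (dyadicPoint n (k + 1)) ω - Z (dyadicPoint n k) ω| ≤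
      K * ((2 : ℝ) ^ (-γ)) ^ n) (t : Set.Icc (0 : ℝ) 1) :
    Tendsto (fun n ↦ Z (dyadicPoint n (dyadicFloor n t)) ω) atTop (𝓝 (dyadicLimit Z t ω)) := by
  refine CauchySeq.tendsto_limUnder ?_
  have hr1 : (2 : ℝ) ^ (-γ) < 1 := Real.rpow_lt_one_of_one_lt_of_neg (by norm_num) (by linarith)
  refine cauchySeq_of_le_geometric ((2 : ℝ) ^ (-γ)) (K * 2 ^ (-γ)) hr1 fun n ↦ ?_
  rw [Real.dist_eq, ← dyadicPoint_succ_two_mul n, mul_assoc, ← pow_succ']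
  have h1 : 2 * dyadicFloor n t ≤ dyadicFloor (n + 1) t := by
    unfold dyadicFloor
    refine Nat.le_floor ?_
    have := Nat.floor_le (mul_nonneg t.2.1 (by positivity : (0 : ℝ) ≤ 2 ^ n))
    push_cast
    rw [pow_succ]
    linarith
  have h2 : dyadicFloor (n + 1) t < 2 * dyadicFloor n t + 2 := by
    unfold dyadicFloor
    rw [Nat.floor_lt (mul_nonneg t.2.1 (by positivity))]
    have := Nat.lt_floor_add_one ((t : ℝ) * 2 ^ n)
    push_cast
    rw [pow_succ]
    linarith
  -- Passing to the next level, the left neighbour either stays or moves one step right, so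
  -- consecutive approximations differ by at most one dyadic increment.
  obtain h3 | h3 : dyadicFloor (n + 1) t = 2 * dyadicFloor n t ∨
      dyadicFloor (n + 1) t = 2 * dyadicFloor n t + 1 := by omega
  · rw [h3, sub_self, abs_zero]
    positivity
  · rw [h3, abs_sub_comm]
    exact h (n + 1) _

lemma abs_dyadicLimit_sub_le {ω : Ω} {K γ : ℝ} (hK : 0 ≤ K) (hγ : 0 < γ)
    (h : ∀ n k : ℕ, |Z (dyadicPoint n (k + 1)) ω - Z (dyadicPoint n k) ω| ≤
      K * ((2 : ℝ) ^ (-γ)) ^ n) {s t : Set.Icc (0 : ℝ) 1} (hst : s ≤ t) :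
    |dyadicLimit Z t ω - dyadicLimit Z s ω| ≤
      2 * K / (1 - (2 : ℝ) ^ (-γ)) * 2 ^ γ * ((t : ℝ) - s) ^ γ := by
  refine le_of_tendsto_of_tendsto
    ((tendsto_dyadicLimit hK hγ h t).sub (tendsto_dyadicLimit hK hγ h s)).abs
    ((((tendsto_dyadicFloor t).sub (tendsto_dyadicFloor s)).rpow_const
      (Or.inr hγ.le)).const_mul (2 * K / (1 - (2 : ℝ) ^ (-γ)) * 2 ^ γ)) (.of_forall fun n ↦ ?_)
  simp only
  rw [← sub_div]
  exact abs_sub_le_rpow_of_dyadic_increments (F := fun n k ↦ Z (dyadicPoint n k) ω) hK hγ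
    (fun n k ↦ by simp only [dyadicPoint_succ_two_mul]) h (dyadicFloor_mono n hst)
    ((dyadicFloor_le n t).trans (by omega))

/-- Distances in the interval are at most `1`, so a bound with exponent `γ` implies the same bound
with any smaller exponent. -/
lemma mem_holderSpace_of_abs_sub_le {u : Set.Icc (0 : ℝ) 1 → ℝ} {C γ γ' : ℝ} (hγ : 0 < γ)
    (hγ' : γ' ≤ γ) (hu : ∀ s t, s ≤ t → |u t - u s| ≤ C * ((t : ℝ) - s) ^ γ) :
    u ∈ holderSpace γ' := by
  have hC : ∀ s t, |u t - u s| ≤ C * |(t : ℝ) - s| ^ γ := by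
    intro s t
    rcases le_total s t with h | h
    · have : (s : ℝ) ≤ t := h
      rw [abs_of_nonneg (a := (t : ℝ) - s) (by linarith)]
      exact hu s t h
    · have : (t : ℝ) ≤ s := h
      rw [abs_sub_comm, abs_sub_comm (t : ℝ), abs_of_nonneg (a := (s : ℝ) - t) (by linarith)]
      exact hu t s h
  have hC0 : 0 ≤ C := by
    have := (abs_nonneg _).trans (hC 0 1)
    simpa using this
  constructor
  · rw [continuous_iff_continuousAt]
    intro s
    rw [ContinuousAt, tendsto_iff_dist_tendsto_zero]
    have hlim : Tendsto (fun t : Set.Icc (0 : ℝ) 1 ↦ C * |(t : ℝ) - s| ^ γ) (𝓝 s) (𝓝 0) := by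
      have hc : Continuous fun t : Set.Icc (0 : ℝ) 1 ↦ C * |(t : ℝ) - s| ^ γ :=
        (((continuous_subtype_val.sub continuous_const).abs).rpow_const
          fun _ ↦ Or.inr hγ.le).const_mul C
      have := hc.tendsto s
      simpa [hγ.ne'] using this
    exact squeeze_zero (fun _ ↦ dist_nonneg) (fun t ↦ hC s t) hlim
  · refine ⟨C, ?_⟩
    rintro _ ⟨t₁, t₂, h12, rfl⟩
    have h12' : (t₁ : ℝ) < t₂ := h12
    have hpos : 0 < |(t₁ : ℝ) - t₂| := abs_pos.2 (by linarith)
    rw [div_le_iff₀ (by positivity)]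
    refine (hC t₂ t₁).trans ?_
    gcongr ?_ * ?_
    refine Real.rpow_le_rpow_of_exponent_ge hpos ?_ hγ'
    rw [abs_sub_comm, abs_of_pos (by linarith)]
    linarith [t₁.2.1, t₂.2.2]

/-- Kolmogorov's continuity criterion for a process with Brownian moment bounds of every order. -/
theorem exists_modification_holder [IsFiniteMeasure P] (hZ : ∀ t, Measurable (Z t))
    (hmom : ∀ p : ℕ, 0 < p → ∃ M : ℝ≥0∞, M ≠ ∞ ∧ ∀ s t : Set.Icc (0 : ℝ) 1,
      ∫⁻ ω, ‖Z t ω - Z s ω‖ₑ ^ (2 * p) ∂P ≤ M * ENNReal.ofReal |(t : ℝ) - s| ^ p) :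
    ∃ Y : Set.Icc (0 : ℝ) 1 → Ω → ℝ, IsModification P Y Z ∧
      ∀ᵐ ω ∂P, ∀ γ ∈ Set.Ico (0 : ℝ) (1 / 2), (fun t ↦ Y t ω) ∈ holderSpace γ := by
  -- With `p = m + 3` and `γ = 1/2 - 1/p`, one has `1 + 2pγ = p - 1 < p`. Starting from `3` keeps
  -- `γ` positive, and countably many exponents suffice.
  have hinc : ∀ m : ℕ, ∀ᵐ ω ∂P, ∃ K : ℝ, 0 ≤ K ∧ ∀ n k : ℕ,
      |Z (dyadicPoint n (k + 1)) ω - Z (dyadicPoint n k) ω| ≤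
        K * ((2 : ℝ) ^ (-(1 / 2 - 1 / ((m : ℝ) + 3)))) ^ n := by
    intro m
    obtain ⟨M, hM, hMb⟩ := hmom (m + 3) (by omega)
    refine ae_exists_dyadic_increments_le hZ (p := m + 3) (by omega) hM hMb ?_
    have : (0 : ℝ) < (m : ℝ) + 3 := by positivity
    push_cast
    have e : 2 * ((m : ℝ) + 3) * (1 / 2 - 1 / (m + 3)) = (m + 3) - 2 := by field_simp
    rw [e]
    linarith
  have hpos : ∀ m : ℕ, 0 < 1 / 2 - 1 / ((m : ℝ) + 3) := by
    intro m
    rw [sub_pos]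
    exact one_div_lt_one_div_of_lt (by norm_num) (by linarith [(Nat.cast_nonneg m : (0 : ℝ) ≤ m)])
  refine ⟨dyadicLimit Z, fun t ↦ ⟨measurable_dyadicLimit hZ t, ?_⟩, ?_⟩
  -- The second moment gives `L²` convergence along dyadic approximations to `Z t`; an almost surely
  -- convergent subsequence identifies the pathwise limit with `Z t`.
  · obtain ⟨M, hM, hMb⟩ := hmom 1 one_pos
    have hL : Tendsto (fun n ↦ eLpNorm (fun ω ↦
        Z (dyadicPoint n (dyadicFloor n t)) ω - Z t ω) 2 P) atTop (𝓝 0) := by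
      have h0 : Tendsto (fun n : ℕ ↦ (M * ENNReal.ofReal ((1 / 2) ^ n)) ^ (1 / 2 : ℝ)) atTop
          (𝓝 0) := by
        have h1 : Tendsto (fun n : ℕ ↦ ENNReal.ofReal ((1 / 2) ^ n)) atTop (𝓝 0) := by
          rw [← ENNReal.ofReal_zero]
          exact ENNReal.tendsto_ofReal
            (tendsto_pow_atTop_nhds_zero_of_lt_one (by norm_num) (by norm_num))
        have h2 := (ENNReal.Tendsto.const_mul h1 (Or.inr hM)).ennrpow_const (1 / 2 : ℝ)
        simpa using h2
      refine tendsto_of_tendsto_of_tendsto_of_le_of_le tendsto_const_nhds h0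
        (fun _ ↦ zero_le) fun n ↦ ?_
      simp only
      rw [eLpNorm_eq_lintegral_rpow_enorm_toReal (by norm_num) (by norm_num)]
      simp only [ENNReal.toReal_ofNat]
      gcongr
      have h3 := hMb t (dyadicPoint n (dyadicFloor n t))
      simp only [mul_one, pow_one] at h3
      simp only [ENNReal.rpow_ofNat]
      refine h3.trans ?_
      gcongr
      rw [abs_sub_comm]
      exact abs_coe_dyadicFloor_sub_le n t
    have hmeasure := tendstoInMeasure_of_tendsto_eLpNorm (p := 2) (by norm_num)
      (fun n ↦ (hZ (dyadicPoint n (dyadicFloor n t))).aestronglyMeasurable)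
      (hZ t).aestronglyMeasurable hL
    obtain ⟨ns, hns, hlim⟩ := hmeasure.exists_seq_tendsto_ae
    filter_upwards [hlim, hinc 0] with ω hω ⟨K, hK, hb⟩
    exact tendsto_nhds_unique ((tendsto_dyadicLimit hK (hpos 0) hb t).comp hns.tendsto_atTop) hω
  · filter_upwards [ae_all_iff.2 hinc] with ω hω γ hγ
    obtain ⟨m, hm⟩ := exists_nat_one_div_lt (sub_pos.2 hγ.2)
    obtain ⟨K, hK, hb⟩ := hω m
    refine mem_holderSpace_of_abs_sub_le (hpos m) ?_
      (fun s t hst ↦ abs_dyadicLimit_sub_le hK (hpos m) hb hst)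
    have : 1 / ((m : ℝ) + 3) ≤ 1 / ((m : ℝ) + 1) :=
      one_div_le_one_div_of_le (by positivity) (by linarith)
    linarith

end Kolmogorov

/-! ### Independence of Brownian increments from the joint past -/

/-- If `A` is independent of `(B, C)` and `B` is independent of `C`, then `(A, B)` is independent
of `C`. -/
lemma ProbabilityTheory.IndepFun.prodMk_left_of_prodMk_right {Ω 𝓐 𝓑 𝓒 : Type*}
    {mΩ : MeasurableSpace Ω} [MeasurableSpace 𝓐] [MeasurableSpace 𝓑] [MeasurableSpace 𝓒]
    {P : Measure Ω} [IsProbabilityMeasure P] {A : Ω → 𝓐} {B : Ω → 𝓑} {C : Ω → 𝓒}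
    (hA : Measurable A) (hB : Measurable B) (hC : Measurable C)
    (h1 : IndepFun A (fun ω ↦ (B ω, C ω)) P) (h2 : IndepFun B C P) :
    IndepFun (fun ω ↦ (A ω, B ω)) C P := by
  have hAB : IndepFun A B P := h1.comp measurable_id measurable_fst
  have hmA : IsProbabilityMeasure (P.map A) := Measure.isProbabilityMeasure_map hA.aemeasurable
  have hmB : IsProbabilityMeasure (P.map B) := Measure.isProbabilityMeasure_map hB.aemeasurable
  have hmC : IsProbabilityMeasure (P.map C) := Measure.isProbabilityMeasure_map hC.aemeasurable
  rw [indepFun_iff_map_prod_eq_prod_map_map hA.aemeasurable (hB.prodMk hC).aemeasurable,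
    (indepFun_iff_map_prod_eq_prod_map_map hB.aemeasurable hC.aemeasurable).1 h2] at h1
  rw [indepFun_iff_map_prod_eq_prod_map_map (hA.prodMk hB).aemeasurable hC.aemeasurable,
    (indepFun_iff_map_prod_eq_prod_map_map hA.aemeasurable hB.aemeasurable).1 hAB]
  have h3 := congrArg (Measure.map MeasurableEquiv.prodAssoc.symm) h1
  rw [Measure.map_map (MeasurableEquiv.measurable _) (hA.prodMk (hB.prodMk hC))] at h3
  rw [← (measurePreserving_prodAssoc (P.map A) (P.map B) (P.map C)).symm.map_eq, ← h3]
  rfl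

section Brownian

variable {Ω : Type*} {mΩ : MeasurableSpace Ω} {P : Measure Ω}
  {X W : Set.Icc (0 : ℝ) 1 → Ω → ℝ}

lemma IsStandardBrownianMotion.isGaussianProcess (hW : IsStandardBrownianMotion W P) :
    IsGaussianProcess W P := by
  have h0 : (⊥ : Set.Icc (0 : ℝ) 1) = 0 := rfl
  refine hW.indep_increments.isGaussianProcess (fun t ↦ ?_) (by rw [h0]; exact hW.start_zero)
  refine (hW.gaussian_increments 0 t t.2.1).hasGaussianLaw.congr ?_
  filter_upwards [hW.start_zero] with ω hω
  rw [hω, sub_zero]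

/-- The increments of a Brownian motion are independent of its past. -/
lemma IsStandardBrownianMotion.indepFun_past_increment (hW : IsStandardBrownianMotion W P)
    {u v : Set.Icc (0 : ℝ) 1} (huv : u ≤ v) :
    IndepFun (fun ω (s : Set.Iic u) ↦ W s ω) (fun ω ↦ W v ω - W u ω) P := by
  have hG := hW.isGaussianProcess
  have h2 : ∀ t, MemLp (W t) 2 P := fun t ↦ (hG.hasGaussianLaw_eval t).memLp_two
  -- The past and the increment are jointly Gaussian, so vanishing covariances suffice for
  -- independence.
  have hjoint : IsGaussianProcess
      (Sum.elim (fun (s : Set.Iic u) ω ↦ W s ω) (fun (_ : Unit) ω ↦ W v ω - W u ω)) P := by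
    classical
    refine hG.of_isGaussianProcess ?_
    rintro (s | _)
    · exact ⟨{s.1}, .proj ⟨s.1, by simp⟩, fun ω ↦ by simp⟩
    · exact ⟨{v, u}, .proj ⟨v, by simp⟩ - .proj ⟨u, by simp⟩, fun ω ↦ by simp⟩
  have h := hjoint.indepFun_of_covariance_eq_zero (fun s ↦ (hW.measurable s).aemeasurable)
    (fun _ ↦ ((hW.measurable v).sub (hW.measurable u)).aemeasurable) (fun s _ ↦ by
      refine IndepFun.covariance_eq_zero ?_ (h2 s) ((h2 v).sub (h2 u))
      have hs : (s : Set.Icc (0 : ℝ) 1) ≤ u := s.2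
      -- `W s` equals `W s - W 0` almost surely, the first of the three increments over `0 ≤ s ≤ u ≤
      -- v`; the third is the one of interest.
      have h3 := (hW.indep_increments 3 ![0, s, u, v] (by
        have h0 : (0 : Set.Icc (0 : ℝ) 1) ≤ s := s.1.2.1
        refine Fin.monotone_iff_le_succ.2 fun i ↦ ?_
        fin_cases i
        exacts [h0, hs, huv])).indepFun (show (0 : Fin 3) ≠ 2 by decide)
      refine h3.congr ?_ .rfl
      filter_upwards [hW.start_zero] with ω hω
      simp [hω])
  exact h.comp measurable_id (measurable_pi_apply ())

/-- The past of `X` is independent of the pair (past of `W`, increment), whose components are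
independent of each other. So the increment is independent of both pasts jointly, and these generate
the filtration at `u`. -/
lemma indepFun_increment_of_measurable_jointFiltration [IsProbabilityMeasure P]
    (hX : ∀ t, Measurable (X t))
    (hW : IsStandardBrownianMotion W P)
    (hXW : IndepFun (fun ω t ↦ X t ω) (fun ω t ↦ W t ω) P) {u v : Set.Icc (0 : ℝ) 1} (huv : u ≤ v)
    {f : Ω → ℝ} (hf : Measurable[jointFiltration X W hX hW.measurable u] f) :
    IndepFun f (fun ω ↦ W v ω - W u ω) P := by
  have h1 : IndepFun (fun ω (s : Set.Iic u) ↦ X s ω)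
      (fun ω ↦ (fun (s : Set.Iic u) ↦ W s ω, W v ω - W u ω)) P :=
    hXW.comp (φ := fun (x : Set.Icc (0 : ℝ) 1 → ℝ) (s : Set.Iic u) ↦ x s)
      (ψ := fun (w : Set.Icc (0 : ℝ) 1 → ℝ) ↦ (fun (s : Set.Iic u) ↦ w s, w v - w u))
      (by fun_prop) (by fun_prop)
  have hXm : Measurable fun ω (s : Set.Iic u) ↦ X s ω := measurable_pi_lambda _ fun s ↦ hX s
  have hWm : Measurable fun ω (s : Set.Iic u) ↦ W s ω :=
    measurable_pi_lambda _ fun s ↦ hW.measurable s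
  have hD : Measurable fun ω ↦ W v ω - W u ω := (hW.measurable v).sub (hW.measurable u)
  have h2 := IndepFun.prodMk_left_of_prodMk_right hXm hWm hD h1 (hW.indepFun_past_increment huv)
  have h3 : IndepFun (fun ω (s : Set.Iic u) ↦ (X s ω, W s ω)) (fun ω ↦ W v ω - W u ω) P :=
    h2.comp (φ := fun (x : (Set.Iic u → ℝ) × (Set.Iic u → ℝ)) s ↦ (x.1 s, x.2 s)) (by fun_prop) measurable_id
  rw [jointFiltration, Filtration.natural_eq_comap] at hf
  rw [IndepFun_iff_Indep] at h3 ⊢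
  exact indep_of_indep_of_le_left h3 hf.comap_le

lemma measurable_jointFiltration_left (hX : ∀ t, Measurable (X t)) (hW : ∀ t, Measurable (W t))
    (t : Set.Icc (0 : ℝ) 1) : Measurable[jointFiltration X W hX hW t] (X t) := by
  have h := (Filtration.stronglyAdapted_natural
    (fun t ↦ ((hX t).prodMk (hW t)).stronglyMeasurable) t).measurable
  exact measurable_fst.comp h

lemma measurable_jointFiltration_right (hX : ∀ t, Measurable (X t)) (hW : ∀ t, Measurable (W t))
    (t : Set.Icc (0 : ℝ) 1) : Measurable[jointFiltration X W hX hW t] (W t) := by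
  have h := (Filtration.stronglyAdapted_natural
    (fun t ↦ ((hX t).prodMk (hW t)).stronglyMeasurable) t).measurable
  exact measurable_snd.comp h

end Brownian

/-! ### The Itô isometry -/

section Isometry

variable {Ω : Type*} {mΩ : MeasurableSpace Ω} {P : Measure Ω}
  {W : Set.Icc (0 : ℝ) 1 → Ω → ℝ}

lemma IsStandardBrownianMotion.memLp_increment (hW : IsStandardBrownianMotion W P)
    {s t : Set.Icc (0 : ℝ) 1} (hst : s ≤ t) : MemLp (fun ω ↦ W t ω - W s ω) 2 P :=
  (hW.gaussian_increments s t hst).hasGaussianLaw.memLp_two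

lemma IsStandardBrownianMotion.integral_increment (hW : IsStandardBrownianMotion W P)
    {s t : Set.Icc (0 : ℝ) 1} (hst : s ≤ t) : ∫ ω, (W t ω - W s ω) ∂P = 0 := by
  rw [(hW.gaussian_increments s t hst).integral_eq, integral_id_gaussianReal]

lemma IsStandardBrownianMotion.integral_increment_sq (hW : IsStandardBrownianMotion W P)
    {s t : Set.Icc (0 : ℝ) 1} (hst : s ≤ t) :
    ∫ ω, (W t ω - W s ω) ^ 2 ∂P = (t : ℝ) - s := by
  have hst' : (s : ℝ) ≤ t := hst
  have hL := hW.gaussian_increments s t hst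
  have h1 := hL.variance_eq
  rw [variance_of_integral_eq_zero hL.aemeasurable (hW.integral_increment hst)] at h1
  simp only [Function.id_def] at h1
  rw [variance_fun_id_gaussianReal] at h1
  rw [h1, Real.coe_toNNReal _ (by linarith)]

/-- `W` is adapted to `𝓕` and its increments after time `u` are independent of `𝓕 u`. -/
structure IsBrownianFiltration (𝓕 : Filtration (Set.Icc (0 : ℝ) 1) mΩ)
    (W : Set.Icc (0 : ℝ) 1 → Ω → ℝ) (P : Measure Ω) : Prop where
  adapted : ∀ t, Measurable[𝓕 t] (W t)
  indep : ∀ u v, u ≤ v → ∀ f : Ω → ℝ, Measurable[𝓕 u] f →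
    IndepFun f (fun ω ↦ W v ω - W u ω) P

variable {𝓕 : Filtration (Set.Icc (0 : ℝ) 1) mΩ}

lemma IsBrownianFiltration.measurable_increment (h𝓕 : IsBrownianFiltration 𝓕 W P)
    {s t u : Set.Icc (0 : ℝ) 1} (hs : s ≤ u) (ht : t ≤ u) :
    Measurable[𝓕 u] fun ω ↦ W t ω - W s ω :=
  ((h𝓕.adapted t).mono (𝓕.mono ht) le_rfl).sub ((h𝓕.adapted s).mono (𝓕.mono hs) le_rfl)

lemma IsBrownianFiltration.integrable_mul_increment [IsFiniteMeasure P]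
    (h𝓕 : IsBrownianFiltration 𝓕 W P)
    (hW : IsStandardBrownianMotion W P) {u v : Set.Icc (0 : ℝ) 1} (huv : u ≤ v) {f : Ω → ℝ}
    (hf : Measurable[𝓕 u] f) (hfi : Integrable f P) :
    Integrable (fun ω ↦ f ω * (W v ω - W u ω)) P :=
  (h𝓕.indep u v huv f hf).integrable_mul hfi ((hW.memLp_increment huv).integrable (by norm_num))

lemma IsBrownianFiltration.integral_mul_increment (h𝓕 : IsBrownianFiltration 𝓕 W P)
    (hW : IsStandardBrownianMotion W P) {u v : Set.Icc (0 : ℝ) 1} (huv : u ≤ v) {f : Ω → ℝ}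
    (hf : Measurable[𝓕 u] f) : ∫ ω, f ω * (W v ω - W u ω) ∂P = 0 := by
  rw [(h𝓕.indep u v huv f hf).integral_fun_mul_eq_mul_integral
    (hf.mono (𝓕.le u) le_rfl).aestronglyMeasurable (hW.memLp_increment huv).1,
    hW.integral_increment huv, mul_zero]

lemma IsBrownianFiltration.integrable_mul_increment_sq (h𝓕 : IsBrownianFiltration 𝓕 W P)
    (hW : IsStandardBrownianMotion W P) {u v : Set.Icc (0 : ℝ) 1} (huv : u ≤ v) {f : Ω → ℝ}
    (hf : Measurable[𝓕 u] f) (hfi : Integrable f P) :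
    Integrable (fun ω ↦ f ω * (W v ω - W u ω) ^ 2) P :=
  ((h𝓕.indep u v huv f hf).comp (φ := id) (ψ := fun x ↦ x ^ 2) measurable_id
    (by fun_prop)).integrable_mul hfi (hW.memLp_increment huv).integrable_sq

lemma IsBrownianFiltration.integral_mul_increment_sq (h𝓕 : IsBrownianFiltration 𝓕 W P)
    (hW : IsStandardBrownianMotion W P) {u v : Set.Icc (0 : ℝ) 1} (huv : u ≤ v) {f : Ω → ℝ}
    (hf : Measurable[𝓕 u] f) :
    ∫ ω, f ω * (W v ω - W u ω) ^ 2 ∂P = (∫ ω, f ω ∂P) * ((v : ℝ) - u) := by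
  have h := ((h𝓕.indep u v huv f hf).comp (φ := id) (ψ := fun x ↦ x ^ 2) measurable_id
    (by fun_prop)).integral_fun_mul_eq_mul_integral
    (hf.mono (𝓕.le u) le_rfl).aestronglyMeasurable
    ((hW.memLp_increment huv).integrable_sq.1)
  simp only [Function.comp_def, id] at h
  rw [h, hW.integral_increment_sq huv]

lemma IsBrownianFiltration.memLp_mul_increment (h𝓕 : IsBrownianFiltration 𝓕 W P)
    (hW : IsStandardBrownianMotion W P) {u v : Set.Icc (0 : ℝ) 1} (huv : u ≤ v) {f : Ω → ℝ}
    (hf : Measurable[𝓕 u] f) (hf2 : MemLp f 2 P) :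
    MemLp (fun ω ↦ f ω * (W v ω - W u ω)) 2 P := by
  refine (memLp_two_iff_integrable_sq (hf2.1.mul (hW.memLp_increment huv).1)).2 ?_
  simp_rw [Pi.mul_apply, mul_pow]
  exact h𝓕.integrable_mul_increment_sq hW huv (hf.pow_const 2) hf2.integrable_sq

/-- Cutting the longer increment at `t` leaves a square plus a product with `W v - W t`, which is
centered and independent of the other factors. -/
lemma IsBrownianFiltration.integral_mul_increment_mul_increment_of_le [IsFiniteMeasure P]
    (h𝓕 : IsBrownianFiltration 𝓕 W P) (hW : IsStandardBrownianMotion W P)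
    {u t v : Set.Icc (0 : ℝ) 1} (hut : u ≤ t) (htv : t ≤ v) {f : Ω → ℝ}
    (hf : Measurable[𝓕 u] f) (hfi : Integrable f P) :
    Integrable (fun ω ↦ f ω * ((W t ω - W u ω) * (W v ω - W u ω))) P ∧
    ∫ ω, f ω * ((W t ω - W u ω) * (W v ω - W u ω)) ∂P = (∫ ω, f ω ∂P) * ((t : ℝ) - u) := by
  have hg : Measurable[𝓕 t] fun ω ↦ f ω * (W t ω - W u ω) :=
    (hf.mono (𝓕.mono hut) le_rfl).mul (h𝓕.measurable_increment hut le_rfl)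
  have e : (fun ω ↦ f ω * ((W t ω - W u ω) * (W v ω - W u ω))) = fun ω ↦
      f ω * (W t ω - W u ω) ^ 2 + (f ω * (W t ω - W u ω)) * (W v ω - W t ω) := by
    ext ω; ring
  have i1 := h𝓕.integrable_mul_increment_sq hW hut hf hfi
  have i2 := h𝓕.integrable_mul_increment hW htv hg (h𝓕.integrable_mul_increment hW hut hf hfi)
  rw [e]
  refine ⟨i1.add i2, ?_⟩
  rw [integral_add i1 i2, h𝓕.integral_mul_increment_sq hW hut hf,
    h𝓕.integral_mul_increment hW htv hg, add_zero]

lemma IsBrownianFiltration.integral_mul_increment_mul_increment [IsFiniteMeasure P]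
    (h𝓕 : IsBrownianFiltration 𝓕 W P) (hW : IsStandardBrownianMotion W P)
    {u t v : Set.Icc (0 : ℝ) 1} (hut : u ≤ t) (huv : u ≤ v) {f : Ω → ℝ}
    (hf : Measurable[𝓕 u] f) (hfi : Integrable f P) :
    Integrable (fun ω ↦ f ω * ((W t ω - W u ω) * (W v ω - W u ω))) P ∧
    ∫ ω, f ω * ((W t ω - W u ω) * (W v ω - W u ω)) ∂P =
      (∫ ω, f ω ∂P) * volume.real (Set.Ioc u (min t v)) := by
  rw [Measure.real, unitInterval.volume_Ioc]
  rcases le_total t v with h | h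
  · have hut' : (u : ℝ) ≤ t := hut
    rw [min_eq_left h, ENNReal.toReal_ofReal (by linarith)]
    exact h𝓕.integral_mul_increment_mul_increment_of_le hW hut h hf hfi
  · have huv' : (u : ℝ) ≤ v := huv
    rw [min_eq_right h, ENNReal.toReal_ofReal (by linarith)]
    simp_rw [mul_comm (W t _ - W u _)]
    exact h𝓕.integral_mul_increment_mul_increment_of_le hW huv h hf hfi

/-- Covariance of two elementary stochastic integrals. -/
lemma IsBrownianFiltration.integral_elementary_mul_elementary [IsFiniteMeasure P]
    (h𝓕 : IsBrownianFiltration 𝓕 W P) (hW : IsStandardBrownianMotion W P)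
    {s t u v : Set.Icc (0 : ℝ) 1} (hst : s ≤ t) (huv : u ≤ v) {c d : Ω → ℝ}
    (hc : Measurable[𝓕 s] c) (hd : Measurable[𝓕 u] d) (hc2 : MemLp c 2 P) (hd2 : MemLp d 2 P) :
    ∫ ω, (c ω * (W t ω - W s ω)) * (d ω * (W v ω - W u ω)) ∂P =
      (∫ ω, c ω * d ω ∂P) * volume.real (Set.Ioc s t ∩ Set.Ioc u v) := by
  wlog hsu : s ≤ u generalizing s t u v c d
  · rw [Set.inter_comm]
    simp_rw [mul_comm (c _), mul_comm (_ * c _)]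
    simp_rw [mul_comm _ (c _)]
    simp_rw [mul_comm (c _) (d _)]
    exact this huv hst hd hc hd2 hc2 (le_of_not_ge hsu)
  rw [Set.Ioc_inter_Ioc, max_eq_right hsu]
  have hc' : Measurable[𝓕 u] c := hc.mono (𝓕.mono hsu) le_rfl
  -- If the intervals are disjoint, the later increment is centered and independent of the rest.
  -- Otherwise the first increment is cut at `u`; its part before `u` contributes zero for the same
  -- reason.
  rcases le_total t u with htu | hut
  · have e : (fun ω ↦ (c ω * (W t ω - W s ω)) * (d ω * (W v ω - W u ω))) = fun ω ↦
        (c ω * (W t ω - W s ω) * d ω) * (W v ω - W u ω) := by ext ω; ring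
    have hm : Measurable[𝓕 u] fun ω ↦ c ω * (W t ω - W s ω) * d ω :=
      (hc'.mul (h𝓕.measurable_increment hsu htu)).mul hd
    rw [e, h𝓕.integral_mul_increment hW huv hm,
      Set.Ioc_eq_empty (not_lt.2 ((min_le_left _ _).trans htu))]
    simp
  · have hcd : Integrable (fun ω ↦ c ω * d ω) P := hc2.integrable_mul hd2
    have hm1 : Measurable[𝓕 u] fun ω ↦ c ω * (W u ω - W s ω) * d ω :=
      (hc'.mul (h𝓕.measurable_increment hsu le_rfl)).mul hd
    have hi1 : Integrable (fun ω ↦ c ω * (W u ω - W s ω) * d ω) P :=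
      (h𝓕.memLp_mul_increment hW hsu hc hc2).integrable_mul hd2
    have hm2 : Measurable[𝓕 u] fun ω ↦ c ω * d ω := hc'.mul hd
    obtain ⟨hi2, he⟩ := h𝓕.integral_mul_increment_mul_increment hW hut huv hm2 hcd
    have e : (fun ω ↦ (c ω * (W t ω - W s ω)) * (d ω * (W v ω - W u ω))) = fun ω ↦
        (c ω * (W u ω - W s ω) * d ω) * (W v ω - W u ω) +
        (c ω * d ω) * ((W t ω - W u ω) * (W v ω - W u ω)) := by ext ω; ring
    rw [e, integral_add (h𝓕.integrable_mul_increment hW huv hm1 hi1) hi2,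
      h𝓕.integral_mul_increment hW huv hm1, zero_add]
    exact he

/-- **Itô isometry** for finite sums of elementary integrands. -/
lemma IsBrownianFiltration.integral_sum_sq_eq [IsFiniteMeasure P]
    (h𝓕 : IsBrownianFiltration 𝓕 W P) (hW : IsStandardBrownianMotion W P)
    {ι : Type*} [Fintype ι] {a b : ι → Set.Icc (0 : ℝ) 1} {c : ι → Ω → ℝ} (hab : ∀ i, a i ≤ b i)
    (hc : ∀ i, Measurable[𝓕 (a i)] (c i)) (hc2 : ∀ i, MemLp (c i) 2 P) :
    ∫ ω, (∑ i, c i ω * (W (b i) ω - W (a i) ω)) ^ 2 ∂P =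
      ∫ p, (∑ i, (Set.Ioc (a i) (b i)).indicator (fun _ ↦ c i p.2) p.1) ^ 2
        ∂((volume : Measure (Set.Icc (0 : ℝ) 1)).prod P) := by
  simp_rw [pow_two, Finset.sum_mul_sum]
  have hprod : ∀ i j, ∀ p : Set.Icc (0 : ℝ) 1 × Ω,
      (Set.Ioc (a i) (b i)).indicator (fun _ ↦ c i p.2) p.1 *
        (Set.Ioc (a j) (b j)).indicator (fun _ ↦ c j p.2) p.1 =
      (Set.Ioc (a i) (b i) ∩ Set.Ioc (a j) (b j)).indicator (fun _ ↦ (1 : ℝ)) p.1 *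
        (c i p.2 * c j p.2) := by
    intro i j p
    by_cases h : p.1 ∈ Set.Ioc (a i) (b i) <;> by_cases h' : p.1 ∈ Set.Ioc (a j) (b j) <;>
      simp [Set.indicator, h, h']
  have hcc : ∀ i j, Integrable (fun ω ↦ c i ω * c j ω) P := fun i j ↦
    (hc2 i).integrable_mul (hc2 j)
  have hmeas : ∀ i j, MeasurableSet (Set.Ioc (a i) (b i) ∩ Set.Ioc (a j) (b j)) := fun i j ↦
    measurableSet_Ioc.inter measurableSet_Ioc
  simp_rw [hprod]
  have hI : ∀ i j, Integrable (fun ω ↦ c i ω * (W (b i) ω - W (a i) ω) *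
      (c j ω * (W (b j) ω - W (a j) ω))) P := fun i j ↦
    (h𝓕.memLp_mul_increment hW (hab i) (hc i) (hc2 i)).integrable_mul
      (h𝓕.memLp_mul_increment hW (hab j) (hc j) (hc2 j))
  have hJ : ∀ i j, Integrable (fun p : Set.Icc (0 : ℝ) 1 × Ω ↦
      (Set.Ioc (a i) (b i) ∩ Set.Ioc (a j) (b j)).indicator (fun _ ↦ (1 : ℝ)) p.1 *
        (c i p.2 * c j p.2)) (volume.prod P) := fun i j ↦
    ((integrable_const (1 : ℝ)).indicator (hmeas i j)).mul_prod (hcc i j)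
  rw [integral_finsetSum _ fun i _ ↦ integrable_finsetSum _ fun j _ ↦ hI i j,
    integral_finsetSum _ fun i _ ↦ integrable_finsetSum _ fun j _ ↦ hJ i j]
  refine Finset.sum_congr rfl fun i _ ↦ ?_
  rw [integral_finsetSum _ fun j _ ↦ hI i j, integral_finsetSum _ fun j _ ↦ hJ i j]
  refine Finset.sum_congr rfl fun j _ ↦ ?_
  rw [h𝓕.integral_elementary_mul_elementary hW (hab i) (hab j) (hc i) (hc j) (hc2 i) (hc2 j)]
  have h := integral_prod_mul (μ := (volume : Measure (Set.Icc (0 : ℝ) 1))) (ν := P)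
    ((Set.Ioc (a i) (b i) ∩ Set.Ioc (a j) (b j)).indicator fun _ ↦ (1 : ℝ))
    (fun ω ↦ c i ω * c j ω)
  rw [h, integral_indicator_const _ (hmeas i j), smul_eq_mul, mul_one, mul_comm]

end Isometry

/-! ### Elementary integrals as contractions of `L²` -/

section SimpleIsometry

variable {Ω : Type*} {mΩ : MeasurableSpace Ω} {P : Measure Ω}
  {W : Set.Icc (0 : ℝ) 1 → Ω → ℝ} {𝓕 : Filtration (Set.Icc (0 : ℝ) 1) mΩ}

/-- The increment of the stopped process over a time interval, as a plain increment. -/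
lemma increment_min_eq {β : Type*} [AddGroup β] (w : Set.Icc (0 : ℝ) 1 → β)
    {a b : Set.Icc (0 : ℝ) 1} (hab : a ≤ b)
    (t : Set.Icc (0 : ℝ) 1) : w (min b t) - w (min a t) = w (max a (min b t)) - w a := by
  rcases le_total a t with h | h
  · rw [min_eq_left h, max_eq_right (le_min hab h)]
  · rw [min_eq_right h, min_eq_right (h.trans hab), max_eq_left h, sub_self, sub_self]

lemma SimpleProcess.integral_eq_sum (V : SimpleProcess 𝓕 P) (t : Set.Icc (0 : ℝ) 1) (ω : Ω) :
    V.integral W t ω = ∑ i, V.coeff i ω *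
      (W (max (V.time i.castSucc) (min (V.time i.succ) t)) ω - W (V.time i.castSucc) ω) := by
  refine Finset.sum_congr rfl fun i _ ↦ ?_
  rw [increment_min_eq (fun s ↦ W s ω) (V.time_mono i.castSucc_le_succ) t]

lemma MeasureTheory.MemLp.eLpNorm_two_eq_of_integral_sq_eq {α β : Type*} {mα : MeasurableSpace α}
    {mβ : MeasurableSpace β} {μ : Measure α} {ν : Measure β} {f : α → ℝ} {g : β → ℝ}
    (hf : MemLp f 2 μ) (hg : MemLp g 2 ν) (h : ∫ x, f x ^ 2 ∂μ = ∫ y, g y ^ 2 ∂ν) :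
    eLpNorm f 2 μ = eLpNorm g 2 ν := by
  rw [hf.eLpNorm_eq_integral_rpow_norm (by norm_num) (by norm_num),
    hg.eLpNorm_eq_integral_rpow_norm (by norm_num) (by norm_num)]
  simp only [ENNReal.toReal_ofNat, Real.rpow_ofNat, Real.norm_eq_abs, sq_abs, h]

lemma SimpleProcess.memLp_integral (h𝓕 : IsBrownianFiltration 𝓕 W P)
    (hW : IsStandardBrownianMotion W P) (V : SimpleProcess 𝓕 P) (t : Set.Icc (0 : ℝ) 1) :
    MemLp (V.integral W t) 2 P := by
  have e : V.integral W t = fun ω ↦ ∑ i, V.coeff i ω *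
      (W (max (V.time i.castSucc) (min (V.time i.succ) t)) ω - W (V.time i.castSucc) ω) :=
    funext fun ω ↦ V.integral_eq_sum t ω
  rw [e]
  exact memLp_finsetSum _ fun i _ ↦ h𝓕.memLp_mul_increment hW (le_max_left _ _)
    (V.coeff_measurable i) (V.coeff_memLp i)

variable [IsFiniteMeasure P]

lemma memLp_indicator_prod {a b : Set.Icc (0 : ℝ) 1} {c : Ω → ℝ} (hc : MemLp c 2 P) :
    MemLp (fun p : Set.Icc (0 : ℝ) 1 × Ω ↦ (Set.Ioc a b).indicator (fun _ ↦ c p.2) p.1) 2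
      (volume.prod P) := by
  have h : MemLp (fun p : Set.Icc (0 : ℝ) 1 × Ω ↦ c p.2) 2 (volume.prod P) :=
    hc.comp_measurePreserving measurePreserving_snd
  exact h.indicator (s := Prod.fst ⁻¹' Set.Ioc a b) (measurable_fst measurableSet_Ioc)

lemma SimpleProcess.memLp_value (V : SimpleProcess 𝓕 P) :
    MemLp (fun p : Set.Icc (0 : ℝ) 1 × Ω ↦ V.value p.1 p.2) 2 (volume.prod P) :=
  memLp_finsetSum _ fun i _ ↦ memLp_indicator_prod (V.coeff_memLp i)

/-- The Itô isometry shows that elementary integrals depend on simple processes in a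
nonexpansive way. -/
lemma SimpleProcess.eLpNorm_integral_sub_le (h𝓕 : IsBrownianFiltration 𝓕 W P)
    (hW : IsStandardBrownianMotion W P) (V V' : SimpleProcess 𝓕 P) (t : Set.Icc (0 : ℝ) 1) :
    eLpNorm (fun ω ↦ V.integral W t ω - V'.integral W t ω) 2 P ≤
      eLpNorm (fun p : Set.Icc (0 : ℝ) 1 × Ω ↦ V.value p.1 p.2 - V'.value p.1 p.2) 2
        (volume.prod P) := by
  -- The isometry allows overlapping intervals, so the difference is one sum over the disjoint union
  -- of the index sets, with no common refinement of the partitions.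
  let a : Fin V.n ⊕ Fin V'.n → Set.Icc (0 : ℝ) 1 :=
    Sum.elim (fun i ↦ V.time i.castSucc) fun i ↦ V'.time i.castSucc
  let b : Fin V.n ⊕ Fin V'.n → Set.Icc (0 : ℝ) 1 :=
    Sum.elim (fun i ↦ max (V.time i.castSucc) (min (V.time i.succ) t))
      fun i ↦ max (V'.time i.castSucc) (min (V'.time i.succ) t)
  let c : Fin V.n ⊕ Fin V'.n → Ω → ℝ := Sum.elim V.coeff fun i ω ↦ -V'.coeff i ω
  have hab : ∀ i, a i ≤ b i := by rintro (i | i) <;> exact le_max_left _ _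
  have hc : ∀ i, Measurable[𝓕 (a i)] (c i) := by
    rintro (i | i)
    exacts [V.coeff_measurable i, (V'.coeff_measurable i).neg]
  have hc2 : ∀ i, MemLp (c i) 2 P := by
    rintro (i | i)
    exacts [V.coeff_memLp i, (V'.coeff_memLp i).neg]
  have e1 : (fun ω ↦ V.integral W t ω - V'.integral W t ω) = fun ω ↦
      ∑ i, c i ω * (W (b i) ω - W (a i) ω) := by
    ext ω
    simp [V.integral_eq_sum, V'.integral_eq_sum, Fintype.sum_sum_type, a, b, c, sub_eq_add_neg]
  -- Stopping at `t` clamps the right end points, which restricts the integrand to times `≤ t` and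
  -- can only decrease its norm.
  have hIoc : ∀ u v : Set.Icc (0 : ℝ) 1, Set.Ioc u (max u (min v t)) = Set.Ioc u v ∩ Set.Iic t := by
    intro u v
    ext x
    simp only [Set.mem_Ioc, le_max_iff, le_min_iff, Set.mem_inter_iff, Set.mem_Iic]
    constructor
    · rintro ⟨h1, h2 | h2⟩
      · exact absurd h1 (not_lt.2 h2)
      · exact ⟨⟨h1, h2.1⟩, h2.2⟩
    · exact fun h ↦ ⟨h.1.1, Or.inr ⟨h.1.2, h.2⟩⟩
  have e2 : ∀ p : Set.Icc (0 : ℝ) 1 × Ω,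
      ∑ i, (Set.Ioc (a i) (b i)).indicator (fun _ ↦ c i p.2) p.1 =
      (Set.Iic t).indicator (fun s ↦ V.value s p.2 - V'.value s p.2) p.1 := by
    rintro ⟨s, ω⟩
    simp only [Fintype.sum_sum_type, a, b, c, Sum.elim_inl, Sum.elim_inr, hIoc,
      SimpleProcess.value]
    by_cases hs : s ≤ t
    · rw [Set.indicator_of_mem (show s ∈ Set.Iic t from hs), sub_eq_add_neg,
        ← Finset.sum_neg_distrib]
      congr 1 <;> refine Finset.sum_congr rfl fun i _ ↦ ?_
      · simp [Set.indicator, hs]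
      · simp only [Set.indicator, Set.mem_inter_iff, Set.mem_Iic, hs, and_true]
        split_ifs <;> simp
    · rw [Set.indicator_of_notMem (show s ∉ Set.Iic t from hs)]
      simp [Set.indicator, hs]
  rw [e1, MemLp.eLpNorm_two_eq_of_integral_sq_eq
    (memLp_finsetSum _ fun i _ ↦ h𝓕.memLp_mul_increment hW (hab i) (hc i) (hc2 i))
    (memLp_finsetSum _ fun i _ ↦ memLp_indicator_prod (hc2 i))
    (h𝓕.integral_sum_sq_eq hW hab hc hc2)]
  refine eLpNorm_mono fun p ↦ ?_
  rw [e2]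
  exact norm_indicator_le_norm_self (fun s ↦ V.value s p.2 - V'.value s p.2) p.1

end SimpleIsometry

/-! ### Uniform moments of the integrand -/

section GaussianMoments

variable {Ω : Type*} {mΩ : MeasurableSpace Ω} {P : Measure Ω}
  {X : Set.Icc (0 : ℝ) 1 → Ω → ℝ}

/-- The variances of a centered Gaussian process with continuous paths on a compact interval are
bounded. -/
lemma exists_hasLaw_gaussianReal_le [IsProbabilityMeasure P] (hX : ∀ t, Measurable (X t))
    (hX_gauss : IsGaussianProcess X P) (hX_centered : ∀ t, ∫ ω, X t ω ∂P = 0)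
    (hX_cont : ∀ᵐ ω ∂P, Continuous fun t ↦ X t ω) :
    ∃ B : ℝ≥0, ∀ t, ∃ v : ℝ≥0, v ≤ B ∧ HasLaw (X t) (gaussianReal 0 v) P := by
  have hlaw : ∀ t, ∃ v : ℝ≥0, HasLaw (X t) (gaussianReal 0 v) P := by
    intro t
    refine ⟨(variance (X t) P).toNNReal, (hX t).aemeasurable, ?_⟩
    have h := (hX_gauss.hasGaussianLaw_eval t).map_eq_gaussianReal
    rw [h, hX_centered]
  choose v hv using hlaw
  -- The characteristic function at `1` has modulus `exp (-v/2)` and is continuous in `t` by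
  -- dominated convergence. Its minimum over the compact interval is attained where the variance is
  -- largest.
  have hcont : Continuous fun t ↦ ∫ ω, Complex.exp (X t ω * Complex.I) ∂P := by
    refine continuous_of_dominated (bound := fun _ ↦ 1) (fun t ↦ ?_) (fun t ↦ ?_)
      (integrable_const _) ?_
    · exact Measurable.aestronglyMeasurable (by have := hX t; fun_prop)
    · exact .of_forall fun ω ↦ by rw [Complex.norm_exp_ofReal_mul_I]
    · filter_upwards [hX_cont] with ω hω
      fun_prop
  have hval : ∀ t, ‖∫ ω, Complex.exp (X t ω * Complex.I) ∂P‖ = Real.exp (-(v t) / 2) := by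
    intro t
    have h1 := charFun_gaussianReal (μ := 0) (v := v t) 1
    rw [← (hv t).map_eq, charFun_apply_real, integral_map (hX t).aemeasurable (by fun_prop)] at h1
    simp only [Complex.ofReal_one, one_mul] at h1
    rw [h1, Complex.norm_exp]
    congr 1
    simp [neg_div]
  obtain ⟨t₀, -, ht₀⟩ := isCompact_univ.exists_isMinOn (Set.univ_nonempty)
    (hcont.norm.continuousOn (s := Set.univ))
  refine ⟨v t₀, fun t ↦ ⟨v t, ?_, hv t⟩⟩
  have h := ht₀ (Set.mem_univ t)
  simp only [Set.mem_ofPred_eq, hval, Real.exp_le_exp] at h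
  have : (v t : ℝ) ≤ v t₀ := by linarith
  exact_mod_cast this

/-- Realizing all variances by scaling one standard Gaussian makes moment bounds monotone in the
variance and gives the factor `v^p` in the `2p`-th moment. -/
lemma gaussianReal_zero_eq_map (v : ℝ≥0) :
    gaussianReal 0 v = (gaussianReal 0 1).map (fun x ↦ √(v : ℝ) * x) := by
  rw [gaussianReal_map_const_mul]
  congr 1
  · simp
  · ext
    simp

lemma lintegral_one_add_mul_abs_pow_lt_top (b : ℝ) (m : ℕ) :
    ∫⁻ x, ENNReal.ofReal ((1 + b * |x|) ^ m) ∂(gaussianReal 0 1) < ∞ := by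
  have h0 : MemLp (id : ℝ → ℝ) m (gaussianReal 0 1) :=
    memLp_id_gaussianReal' (m : ℝ≥0∞) (ENNReal.natCast_ne_top m)
  have h1 : MemLp (fun x : ℝ ↦ b * |x|) m (gaussianReal 0 1) := h0.norm.const_mul b
  have hc : MemLp (fun _ : ℝ ↦ (1 : ℝ)) m (gaussianReal 0 1) := memLp_const 1
  have h : MemLp (fun x : ℝ ↦ 1 + b * |x|) m (gaussianReal 0 1) := hc.add h1
  have h2 : Integrable (fun x : ℝ ↦ ‖1 + b * |x|‖ ^ m) (gaussianReal 0 1) := h.integrable_norm_pow'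
  refine lt_of_le_of_lt (lintegral_mono fun x ↦ ENNReal.ofReal_le_ofReal ?_) h2.lintegral_lt_top
  rw [← norm_pow]
  exact le_abs_self _

/-- Uniform moment bounds for a function of polynomial growth of a Gaussian process. -/
lemma exists_lintegral_comp_pow_le {B : ℝ≥0}
    (hlaw : ∀ t, ∃ v : ℝ≥0, v ≤ B ∧ HasLaw (X t) (gaussianReal 0 v) P) {Φ : ℝ → ℝ}
    (hΦ : Measurable Φ) {c L : ℝ} (hgrowth : ∀ x, |Φ x| ≤ c * (1 + |x|) ^ L) (q : ℕ) :
    ∃ M : ℝ≥0∞, M ≠ ∞ ∧ ∀ t, ∫⁻ ω, ‖Φ (X t ω)‖ₑ ^ q ∂P ≤ M := by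
  have hc : 0 ≤ c := by simpa using (abs_nonneg _).trans (hgrowth 0)
  set N : ℕ := ⌈L⌉₊
  refine ⟨ENNReal.ofReal (c ^ q) *
    ∫⁻ x, ENNReal.ofReal ((1 + √(B : ℝ) * |x|) ^ (N * q)) ∂(gaussianReal 0 1),
    ENNReal.mul_ne_top (by simp) (lintegral_one_add_mul_abs_pow_lt_top _ _).ne, fun t ↦ ?_⟩
  obtain ⟨v, hvB, hv⟩ := hlaw t
  rw [hv.lintegral_comp (f := fun x ↦ ‖Φ x‖ₑ ^ q) (by fun_prop), gaussianReal_zero_eq_map,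
    lintegral_map (by fun_prop) (by fun_prop), ← lintegral_const_mul _ (by fun_prop)]
  refine lintegral_mono fun x ↦ ?_
  rw [← ENNReal.ofReal_mul (by positivity), Real.enorm_eq_ofReal_abs,
    ← ENNReal.ofReal_pow (abs_nonneg _)]
  refine ENNReal.ofReal_le_ofReal ?_
  rw [pow_mul, ← mul_pow]
  gcongr
  refine (hgrowth _).trans ?_
  gcongr
  have h1 : (1 : ℝ) ≤ 1 + |√(v : ℝ) * x| := by linarith [abs_nonneg (√(v : ℝ) * x)]
  calc (1 + |√(v : ℝ) * x|) ^ L ≤ (1 + |√(v : ℝ) * x|) ^ (N : ℝ) :=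
        Real.rpow_le_rpow_of_exponent_le h1 (Nat.le_ceil L)
    _ = (1 + |√(v : ℝ) * x|) ^ N := Real.rpow_natCast _ _
    _ ≤ (1 + √(B : ℝ) * |x|) ^ N := by
        gcongr
        rw [abs_mul, abs_of_nonneg (Real.sqrt_nonneg _)]
        gcongr

end GaussianMoments

/-! ### Uniform integrability from fourth moments -/

section UniformIntegrability

/-- A sequence bounded in `L⁴` is uniformly integrable in `L²`. -/
lemma unifIntegrable_two_of_lintegral_pow_four_le {α : Type*} {mα : MeasurableSpace α}
    {μ : Measure α} {f : ℕ → α → ℝ} (hf : ∀ n, AEStronglyMeasurable (f n) μ) {M : ℝ≥0∞}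
    (hM : M ≠ ∞) (h : ∀ n, ∫⁻ x, ‖f n x‖ₑ ^ 4 ∂μ ≤ M) : UnifIntegrable f 2 μ := by
  refine unifIntegrable_of (by norm_num) (by norm_num) hf fun ε hε ↦ ?_
  -- Where `|f| ≥ C` one has `f² ≤ C⁻² f⁴`, so the tail norm is at most `√M / C`; the added `1`
  -- keeps `C` nonzero.
  set C : ℝ≥0 := (M ^ (1 / 2 : ℝ)).toNNReal / ε.toNNReal + 1 with hC
  have hε' : 0 < ε.toNNReal := Real.toNNReal_pos.2 hε
  have hC0 : (C : ℝ≥0∞) ≠ 0 := by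
    rw [hC]; exact_mod_cast (by positivity : (0 : ℝ≥0) < _ + 1).ne'
  refine ⟨C, fun n ↦ ?_⟩
  rw [eLpNorm_eq_lintegral_rpow_enorm_toReal (by norm_num) (by norm_num)]
  simp only [ENNReal.toReal_ofNat, ENNReal.rpow_ofNat]
  have hpt : ∀ x, ‖{x | C ≤ ‖f n x‖₊}.indicator (f n) x‖ₑ ^ 2 ≤
      (C : ℝ≥0∞)⁻¹ ^ 2 * ‖f n x‖ₑ ^ 4 := by
    intro x
    by_cases hx : C ≤ ‖f n x‖₊
    · rw [Set.indicator_of_mem (show x ∈ {x | C ≤ ‖f n x‖₊} from hx),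
        show ‖f n x‖ₑ ^ 4 = (‖f n x‖ₑ ^ 2) * ‖f n x‖ₑ ^ 2 by ring, ← mul_assoc, ← mul_pow]
      refine le_mul_of_one_le_left zero_le (one_le_pow₀ ?_)
      calc (1 : ℝ≥0∞) = (C : ℝ≥0∞)⁻¹ * C := (ENNReal.inv_mul_cancel hC0 (by simp)).symm
        _ ≤ (C : ℝ≥0∞)⁻¹ * ‖f n x‖ₑ := by
          gcongr
          exact_mod_cast hx
    · rw [Set.indicator_of_notMem (show x ∉ {x | C ≤ ‖f n x‖₊} from hx)]
      simp
  calc (∫⁻ x, ‖{x | C ≤ ‖f n x‖₊}.indicator (f n) x‖ₑ ^ 2 ∂μ) ^ (1 / 2 : ℝ)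
      ≤ ((C : ℝ≥0∞)⁻¹ ^ 2 * M) ^ (1 / 2 : ℝ) := by
        gcongr
        refine (lintegral_mono hpt).trans ?_
        rw [lintegral_const_mul' _ _ (by simp [hC0])]
        gcongr
        exact h n
    _ = (C : ℝ≥0∞)⁻¹ * M ^ (1 / 2 : ℝ) := by
        rw [ENNReal.mul_rpow_of_nonneg _ _ (by norm_num), ← ENNReal.rpow_natCast,
          ← ENNReal.rpow_mul]
        norm_num
    _ ≤ ENNReal.ofReal ε := by
        have hMt : M ^ (1 / 2 : ℝ) ≠ ∞ := ENNReal.rpow_ne_top_of_nonneg (by norm_num) hM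
        rw [mul_comm, ← div_eq_mul_inv]
        refine ENNReal.div_le_of_le_mul ?_
        rw [← ENNReal.coe_toNNReal hMt, ENNReal.ofReal, ← ENNReal.coe_mul, ENNReal.coe_le_coe, hC,
          mul_add, mul_div_cancel₀ _ hε'.ne']
        exact le_self_add

end UniformIntegrability

/-! ### Higher moments of sums with independent coefficients -/

section MomentBound

variable {Ω : Type*} {mΩ : MeasurableSpace Ω} {P : Measure Ω} [IsProbabilityMeasure P]
  {W : Set.Icc (0 : ℝ) 1 → Ω → ℝ}

/-- Law of a linear combination of successive Brownian increments. -/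
lemma IsStandardBrownianMotion.hasLaw_sum_increments (hW : IsStandardBrownianMotion W P) {n : ℕ}
    {τ : Fin (n + 1) → Set.Icc (0 : ℝ) 1} (hτ : Monotone τ) (a : Fin n → ℝ) :
    HasLaw (fun ω ↦ ∑ i, a i * (W (τ i.succ) ω - W (τ i.castSucc) ω))
      (gaussianReal 0 (∑ i, a i ^ 2 * ((τ i.succ : ℝ) - τ i.castSucc)).toNNReal) P := by
  have hle : ∀ i : Fin n, τ i.castSucc ≤ τ i.succ := fun i ↦ hτ i.castSucc_le_succ
  have h2 : ∀ i : Fin n, MemLp (fun ω ↦ a i * (W (τ i.succ) ω - W (τ i.castSucc) ω)) 2 P :=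
    fun i ↦ (hW.memLp_increment (hle i)).const_mul (a i)
  have hm : Measurable fun ω ↦ ∑ i, a i * (W (τ i.succ) ω - W (τ i.castSucc) ω) :=
    Finset.measurable_sum _ fun i _ ↦ ((hW.measurable _).sub (hW.measurable _)).const_mul _
  have hG : HasGaussianLaw (fun ω ↦ ∑ i, a i * (W (τ i.succ) ω - W (τ i.castSucc) ω)) P := by
    have h := hW.isGaussianProcess.hasGaussianLaw_increments (t := τ)
    have h' := h.map (∑ i, a i • ContinuousLinearMap.proj (R := ℝ) (φ := fun _ : Fin n ↦ ℝ) i)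
    refine h'.congr (.of_forall fun ω ↦ ?_)
    simp
  have hmean : ∫ ω, (∑ i, a i * (W (τ i.succ) ω - W (τ i.castSucc) ω)) ∂P = 0 := by
    rw [integral_finsetSum _ fun i _ ↦ (h2 i).integrable (by norm_num)]
    refine Finset.sum_eq_zero fun i _ ↦ ?_
    rw [integral_const_mul, hW.integral_increment (hle i), mul_zero]
  have hvar : Var[fun ω ↦ ∑ i, a i * (W (τ i.succ) ω - W (τ i.castSucc) ω); P] =
      ∑ i, a i ^ 2 * ((τ i.succ : ℝ) - τ i.castSucc) := by
    have hind : iIndepFun (fun (i : Fin n) ω ↦ a i * (W (τ i.succ) ω - W (τ i.castSucc) ω)) P :=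
      (hW.indep_increments n τ hτ).comp (fun i x ↦ a i * x) fun i ↦ by fun_prop
    have h := IndepFun.variance_sum (s := Finset.univ) (fun i _ ↦ h2 i)
      fun i _ j _ hij ↦ hind.indepFun hij
    have e : (fun ω ↦ ∑ i, a i * (W (τ i.succ) ω - W (τ i.castSucc) ω)) =
        ∑ i, fun ω ↦ a i * (W (τ i.succ) ω - W (τ i.castSucc) ω) := by
      ext ω; simp
    rw [e, h]
    refine Finset.sum_congr rfl fun i _ ↦ ?_
    rw [variance_const_mul, variance_of_integral_eq_zero
      (hW.memLp_increment (hle i)).aemeasurable (hW.integral_increment (hle i)),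
      hW.integral_increment_sq (hle i)]
  refine ⟨hm.aemeasurable, ?_⟩
  rw [hG.map_eq_gaussianReal, hmean, hvar]

lemma lintegral_enorm_pow_gaussianReal (v : ℝ≥0) (p : ℕ) :
    ∫⁻ x, ‖x‖ₑ ^ (2 * p) ∂(gaussianReal 0 v) =
      (v : ℝ≥0∞) ^ p * ∫⁻ x, ‖x‖ₑ ^ (2 * p) ∂(gaussianReal 0 1) := by
  rw [gaussianReal_zero_eq_map, lintegral_map (by fun_prop) (by fun_prop),
    ← lintegral_const_mul _ (by fun_prop)]
  refine lintegral_congr fun x ↦ ?_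
  rw [enorm_mul, mul_pow, pow_mul ‖√(v : ℝ)‖ₑ, ← enorm_pow, Real.sq_sqrt (NNReal.coe_nonneg v)]
  congr 2
  simp

lemma lintegral_enorm_pow_gaussianReal_ne_top (p : ℕ) :
    ∫⁻ x, ‖x‖ₑ ^ p ∂(gaussianReal 0 1) ≠ ∞ := by
  have h0 : MemLp (id : ℝ → ℝ) p (gaussianReal 0 1) :=
    memLp_id_gaussianReal' (p : ℝ≥0∞) (ENNReal.natCast_ne_top p)
  have h := h0.integrable_norm_pow'.2
  simpa [HasFiniteIntegral, enorm_pow] using h.ne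

lemma ProbabilityTheory.IndepFun.lintegral_eq_lintegral_lintegral {𝓐 𝓑 : Type*}
    [MeasurableSpace 𝓐] [MeasurableSpace 𝓑] {A : Ω → 𝓐} {G : Ω → 𝓑} (hA : Measurable A)
    (hG : Measurable G) (h : IndepFun A G P) {F : 𝓐 → 𝓑 → ℝ≥0∞}
    (hF : Measurable (Function.uncurry F)) :
    ∫⁻ ω, F (A ω) (G ω) ∂P = ∫⁻ ω, ∫⁻ ω', F (A ω) (G ω') ∂P ∂P := by
  have hmG : IsProbabilityMeasure (P.map G) := Measure.isProbabilityMeasure_map hG.aemeasurable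
  calc ∫⁻ ω, F (A ω) (G ω) ∂P
      = ∫⁻ x, Function.uncurry F x ∂(P.map fun ω ↦ (A ω, G ω)) := by
        rw [lintegral_map hF (hA.prodMk hG)]; rfl
    _ = ∫⁻ a, ∫⁻ g, F a g ∂(P.map G) ∂(P.map A) := by
        rw [(indepFun_iff_map_prod_eq_prod_map_map hA.aemeasurable hG.aemeasurable).1 h,
          lintegral_prod _ hF.aemeasurable]
        rfl
    _ = ∫⁻ ω, ∫⁻ g, F (A ω) g ∂(P.map G) ∂P := by
        rw [lintegral_map hF.lintegral_prod_right hA]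
    _ = _ := by
        refine lintegral_congr fun ω ↦ ?_
        exact lintegral_map (hF.comp (measurable_const.prodMk measurable_id)) hG

/-- Jensen's inequality for `y ↦ y^p` with weights `δ i / ∑ δ`; the case of zero total weight is
separate. -/
lemma Finset.pow_sum_mul_le {ι : Type*} (s : Finset ι) {δ y : ι → ℝ} (hδ : ∀ i ∈ s, 0 ≤ δ i)
    (hy : ∀ i ∈ s, 0 ≤ y i) {p : ℕ} (hp : 0 < p) :
    (∑ i ∈ s, δ i * y i) ^ p ≤ (∑ i ∈ s, δ i) ^ (p - 1) * ∑ i ∈ s, δ i * y i ^ p := by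
  set D := ∑ i ∈ s, δ i with hD
  obtain ⟨p, rfl⟩ : ∃ q, p = q + 1 := ⟨p - 1, by omega⟩
  rcases (Finset.sum_nonneg hδ).eq_or_lt with h0 | h0
  · have h1 : ∀ i ∈ s, δ i = 0 := (Finset.sum_eq_zero_iff_of_nonneg hδ).1 h0.symm
    rw [Finset.sum_eq_zero fun i hi ↦ by rw [h1 i hi, zero_mul],
      Finset.sum_eq_zero (f := fun i ↦ δ i * y i ^ (p + 1)) fun i hi ↦ by rw [h1 i hi, zero_mul]]
    simp
  · have h := Real.pow_arith_mean_le_arith_mean_pow s (fun i ↦ δ i / D) y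
      (fun i hi ↦ div_nonneg (hδ i hi) h0.le)
      (by rw [← Finset.sum_div, div_self h0.ne']) hy (p + 1)
    simp_rw [div_mul_eq_mul_div, ← Finset.sum_div] at h
    rw [div_pow, div_le_div_iff₀ (pow_pos h0 _) h0] at h
    rw [Nat.add_sub_cancel]
    refine le_of_mul_le_mul_right (h.trans (le_of_eq ?_)) h0
    rw [← hD]
    ring

/-- Moments of a stochastic integral sum whose coefficients are independent of the Brownian
motion. -/
lemma IsStandardBrownianMotion.lintegral_sum_mul_increments_pow_le
    (hW : IsStandardBrownianMotion W P) {n : ℕ} {τ : Fin (n + 1) → Set.Icc (0 : ℝ) 1}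
    (hτ : Monotone τ) {A : Fin n → Ω → ℝ} (hA : ∀ i, Measurable (A i))
    (hAW : IndepFun (fun ω i ↦ A i ω) (fun ω t ↦ W t ω) P) {p : ℕ} (hp : 0 < p) {M : ℝ≥0∞}
    (hM : ∀ i, ∫⁻ ω, ‖A i ω‖ₑ ^ (2 * p) ∂P ≤ M) :
    ∫⁻ ω, ‖∑ i, A i ω * (W (τ i.succ) ω - W (τ i.castSucc) ω)‖ₑ ^ (2 * p) ∂P ≤
      (∫⁻ x, ‖x‖ₑ ^ (2 * p) ∂(gaussianReal 0 1)) * M *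
        ENNReal.ofReal ((τ (Fin.last n) : ℝ) - τ 0) ^ p := by
  set m := ∫⁻ x, ‖x‖ₑ ^ (2 * p) ∂(gaussianReal 0 1)
  set δ : Fin n → ℝ := fun i ↦ (τ i.succ : ℝ) - τ i.castSucc with hδ
  have hδ0 : ∀ i, 0 ≤ δ i := fun i ↦ by
    have : (τ i.castSucc : ℝ) ≤ τ i.succ := hτ i.castSucc_le_succ
    simp only [hδ]; linarith
  have hδs : ∑ i, δ i = (τ (Fin.last n) : ℝ) - τ 0 := by
    have h1 := Fin.sum_univ_succ fun i ↦ (τ i : ℝ)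
    have h2 := Fin.sum_univ_castSucc fun i ↦ (τ i : ℝ)
    simp only [hδ, Finset.sum_sub_distrib]
    linarith
  have hτ0 : 0 ≤ (τ (Fin.last n) : ℝ) - τ 0 := hδs ▸ Finset.sum_nonneg fun i _ ↦ hδ0 i
  have hG : Measurable fun ω (i : Fin n) ↦ W (τ i.succ) ω - W (τ i.castSucc) ω :=
    measurable_pi_lambda _ fun i ↦ (hW.measurable _).sub (hW.measurable _)
  have hind : IndepFun (fun ω i ↦ A i ω)
      (fun ω (i : Fin n) ↦ W (τ i.succ) ω - W (τ i.castSucc) ω) P :=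
    hAW.comp (φ := id) (ψ := fun (w : Set.Icc (0 : ℝ) 1 → ℝ) (i : Fin n) ↦
      w (τ i.succ) - w (τ i.castSucc)) measurable_id (by fun_prop)
  -- For frozen coefficients the sum is Gaussian with variance `∑ δᵢ aᵢ²`. Jensen moves the power
  -- `p` onto the `aᵢ²`, so only the individual moments of the coefficients are needed.
  have hinner : ∀ a : Fin n → ℝ,
      ∫⁻ ω, ‖∑ i, a i * (W (τ i.succ) ω - W (τ i.castSucc) ω)‖ₑ ^ (2 * p) ∂P ≤
        m * (ENNReal.ofReal ((τ (Fin.last n) : ℝ) - τ 0) ^ (p - 1) *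
          ∑ i, ENNReal.ofReal (δ i) * ‖a i‖ₑ ^ (2 * p)) := by
    intro a
    rw [(hW.hasLaw_sum_increments hτ a).lintegral_comp (f := fun x ↦ ‖x‖ₑ ^ (2 * p))
      (by fun_prop), lintegral_enorm_pow_gaussianReal, mul_comm]
    gcongr
    have h := Finset.univ.pow_sum_mul_le (fun i _ ↦ hδ0 i) (fun i _ ↦ sq_nonneg (a i)) hp
    rw [hδs] at h
    simp_rw [mul_comm (a _ ^ 2)]
    change ENNReal.ofReal _ ^ p ≤ _
    rw [← ENNReal.ofReal_pow (Finset.sum_nonneg fun i _ ↦ mul_nonneg (hδ0 i) (sq_nonneg _))]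
    refine (ENNReal.ofReal_le_ofReal h).trans (le_of_eq ?_)
    rw [ENNReal.ofReal_mul (by positivity), ENNReal.ofReal_pow hτ0,
      ENNReal.ofReal_sum_of_nonneg fun i _ ↦ mul_nonneg (hδ0 i) (by positivity)]
    congr 1
    refine Finset.sum_congr rfl fun i _ ↦ ?_
    rw [ENNReal.ofReal_mul (hδ0 i), ← pow_mul, Real.enorm_eq_ofReal_abs,
      ← ENNReal.ofReal_pow (abs_nonneg _), pow_mul, pow_mul, sq_abs]
  have hF : Measurable (Function.uncurry fun (a g : Fin n → ℝ) ↦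
      ‖∑ i, a i * g i‖ₑ ^ (2 * p)) := by
    unfold Function.uncurry
    fun_prop
  rw [hind.lintegral_eq_lintegral_lintegral (measurable_pi_lambda _ hA) hG hF]
  calc ∫⁻ ω, ∫⁻ ω', ‖∑ i, A i ω * (W (τ i.succ) ω' - W (τ i.castSucc) ω')‖ₑ ^ (2 * p) ∂P ∂P
      ≤ ∫⁻ ω, m * (ENNReal.ofReal ((τ (Fin.last n) : ℝ) - τ 0) ^ (p - 1) *
          ∑ i, ENNReal.ofReal (δ i) * ‖A i ω‖ₑ ^ (2 * p)) ∂P :=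
        lintegral_mono fun ω ↦ hinner fun i ↦ A i ω
    _ = m * (ENNReal.ofReal ((τ (Fin.last n) : ℝ) - τ 0) ^ (p - 1) *
          ∑ i, ENNReal.ofReal (δ i) * ∫⁻ ω, ‖A i ω‖ₑ ^ (2 * p) ∂P) := by
        have hAm : ∀ i, Measurable fun ω ↦ ‖A i ω‖ₑ ^ (2 * p) := fun i ↦
          (hA i).enorm.pow_const _
        have hAm' : ∀ i, Measurable fun ω ↦ ENNReal.ofReal (δ i) * ‖A i ω‖ₑ ^ (2 * p) := fun i ↦
          (hAm i).const_mul _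
        have hsum : Measurable fun ω ↦ ∑ i, ENNReal.ofReal (δ i) * ‖A i ω‖ₑ ^ (2 * p) :=
          Finset.measurable_sum _ fun i _ ↦ hAm' i
        rw [lintegral_const_mul _ (hsum.const_mul _), lintegral_const_mul _ hsum,
          lintegral_finsetSum _ fun i _ ↦ hAm' i]
        congr 2
        exact Finset.sum_congr rfl fun i _ ↦ lintegral_const_mul _ (hAm i)
    _ ≤ m * (ENNReal.ofReal ((τ (Fin.last n) : ℝ) - τ 0) ^ (p - 1) *
          ∑ i, ENNReal.ofReal (δ i) * M) := by
        gcongr with i _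
        exact hM i
    _ = _ := by
        rw [← Finset.sum_mul, ← ENNReal.ofReal_sum_of_nonneg fun i _ ↦ hδ0 i, hδs, ← mul_assoc,
          ← mul_assoc, mul_assoc m, ← pow_succ, Nat.sub_add_cancel hp]
        ring

end MomentBound

/-! ### Left-endpoint step processes -/

/-- The point `k / (n + 1)` of the unit interval, with the convention that it is `1` for
`k > n`. -/
noncomputable def gridPoint (n k : ℕ) : Set.Icc (0 : ℝ) 1 :=
  Set.projIcc 0 1 zero_le_one ((k : ℝ) / (n + 1))

lemma gridPoint_mono (n : ℕ) : Monotone (gridPoint n) := fun k l h ↦ by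
  refine Set.monotone_projIcc _ ?_
  gcongr

lemma coe_gridPoint {n k : ℕ} (h : k ≤ n + 1) : (gridPoint n k : ℝ) = k / (n + 1) := by
  have h' : (k : ℝ) ≤ n + 1 := by exact_mod_cast h
  unfold gridPoint
  rw [Set.projIcc_of_mem zero_le_one ⟨by positivity, by rw [div_le_one (by positivity)]; exact h'⟩]

/-- Used to write the integral between `s` and `t` as a sum over the partition clamped to `[s, t]`.
-/
lemma sub_min_eq_sub_clamp {β : Type*} [AddGroup β] (w : Set.Icc (0 : ℝ) 1 → β)
    {s t : Set.Icc (0 : ℝ) 1} (hst : s ≤ t) (u : Set.Icc (0 : ℝ) 1) :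
    w (min u t) - w (min u s) = w (max s (min u t)) - w s := by
  rcases le_total u s with h | h
  · rw [min_eq_left h, min_eq_left (h.trans hst), max_eq_left h, sub_self, sub_self]
  · rw [min_eq_right h, max_eq_right (le_min h hst)]

section StepProcess

variable {Ω : Type*} {mΩ : MeasurableSpace Ω} {P : Measure Ω}
  {𝓕 : Filtration (Set.Icc (0 : ℝ) 1) mΩ} {H W : Set.Icc (0 : ℝ) 1 → Ω → ℝ}

/-- The simple process sampling `H` at the left end points of a uniform grid. -/
noncomputable def leftStep (hH : ∀ t, Measurable[𝓕 t] (H t)) (hH2 : ∀ t, MemLp (H t) 2 P) (n : ℕ) :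
    SimpleProcess 𝓕 P where
  n := n + 1
  time k := gridPoint n k
  time_mono := fun _ _ h ↦ gridPoint_mono n (Fin.le_def.1 h)
  coeff i := H (gridPoint n i)
  coeff_measurable _ := hH _
  coeff_memLp _ := hH2 _

lemma leftStep_value_zero (hH : ∀ t, Measurable[𝓕 t] (H t)) (hH2 : ∀ t, MemLp (H t) 2 P) (n : ℕ)
    (ω : Ω) : (leftStep hH hH2 n).value 0 ω = 0 := by
  refine Finset.sum_eq_zero fun i _ ↦ Set.indicator_of_notMem (fun h ↦ ?_) _
  exact absurd h.1 (not_lt.2 ((leftStep hH hH2 n).time i.castSucc).2.1)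

lemma exists_leftStep_value_eq (hH : ∀ t, Measurable[𝓕 t] (H t)) (hH2 : ∀ t, MemLp (H t) 2 P)
    (n : ℕ) {s : Set.Icc (0 : ℝ) 1} (hs : 0 < s) :
    ∃ u : Set.Icc (0 : ℝ) 1, |(u : ℝ) - s| ≤ 1 / (n + 1) ∧
      ∀ ω, (leftStep hH hH2 n).value s ω = H u ω := by
  have hs0 : (0 : ℝ) < s := hs
  have hn : (0 : ℝ) < n + 1 := by positivity
  set k := ⌈(s : ℝ) * (n + 1)⌉₊ with hk
  have hk0 : 0 < k := Nat.ceil_pos.2 (by positivity)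
  have hkn : k ≤ n + 1 := by
    refine Nat.ceil_le.2 ?_
    push_cast
    exact mul_le_of_le_one_left hn.le s.2.2
  obtain ⟨l, hl⟩ : ∃ l, k = l + 1 := ⟨k - 1, by omega⟩
  have hle : (s : ℝ) * (n + 1) ≤ l + 1 := by
    have := Nat.le_ceil ((s : ℝ) * (n + 1))
    rw [← hk, hl] at this
    exact_mod_cast this
  have hlt : (l : ℝ) < s * (n + 1) := by
    have := Nat.ceil_lt_add_one (a := (s : ℝ) * (n + 1)) (by positivity)
    rw [← hk, hl] at this
    push_cast at this
    linarith
  have hmem : ∀ j : ℕ, j < n + 1 → (s ∈ Set.Ioc (gridPoint n j) (gridPoint n (j + 1)) ↔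
      (j : ℝ) < (s : ℝ) * (n + 1) ∧ (s : ℝ) * (n + 1) ≤ (j : ℝ) + 1) := by
    intro j hj
    rw [Set.mem_Ioc, ← Subtype.coe_lt_coe, ← Subtype.coe_le_coe, coe_gridPoint hj.le,
      coe_gridPoint (by omega), div_lt_iff₀ hn, le_div_iff₀ hn]
    push_cast
    rfl
  refine ⟨gridPoint n l, ?_, fun ω ↦ ?_⟩
  · rw [coe_gridPoint (by omega), abs_sub_comm, abs_of_nonneg, le_div_iff₀ hn, sub_mul,
      div_mul_cancel₀ _ hn.ne']
    · linarith
    · rw [sub_nonneg, div_le_iff₀ hn]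
      exact hlt.le
  · unfold SimpleProcess.value
    refine (Finset.sum_eq_single (⟨l, by change l < n + 1; omega⟩ :
      Fin (leftStep hH hH2 n).n) (fun j _ hj ↦ ?_) (by simp)).trans ?_
    · refine Set.indicator_of_notMem (fun h ↦ hj ?_) _
      obtain ⟨h1, h2⟩ := (hmem j j.2).1 h
      have h3 : (j : ℕ) < l + 1 := by exact_mod_cast h1.trans_le hle
      have h4 : l < (j : ℕ) + 1 := by exact_mod_cast hlt.trans_le h2
      ext
      simp only
      omega
    · exact Set.indicator_of_mem ((hmem l (by omega)).2 ⟨hlt, hle⟩) _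

lemma tendsto_leftStep_value (hH : ∀ t, Measurable[𝓕 t] (H t)) (hH2 : ∀ t, MemLp (H t) 2 P)
    {s : Set.Icc (0 : ℝ) 1} (hs : 0 < s) {ω : Ω} (hω : Continuous fun t ↦ H t ω) :
    Tendsto (fun n ↦ (leftStep hH hH2 n).value s ω) atTop (𝓝 (H s ω)) := by
  choose u hu hval using fun n ↦ exists_leftStep_value_eq hH hH2 n hs
  simp_rw [hval]
  refine (hω.tendsto s).comp ?_
  rw [tendsto_iff_dist_tendsto_zero]
  exact squeeze_zero (fun _ ↦ dist_nonneg) (fun n ↦ hu n) tendsto_one_div_add_atTop_nhds_zero_nat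

lemma ae_tendsto_leftStep_value (hH : ∀ t, Measurable[𝓕 t] (H t)) (hH2 : ∀ t, MemLp (H t) 2 P)
    (hHc : ∀ᵐ ω ∂P, Continuous fun t ↦ H t ω) :
    ∀ᵐ p ∂((volume : Measure (Set.Icc (0 : ℝ) 1)).prod P),
      Tendsto (fun n ↦ (leftStep hH hH2 n).value p.1 p.2) atTop (𝓝 (H p.1 p.2)) := by
  -- The partition intervals are open on the left, so the step processes vanish at time `0`; this
  -- single time is negligible.
  have h1 : ∀ᵐ s : Set.Icc (0 : ℝ) 1, s ≠ 0 := by simp [ae_iff]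
  filter_upwards [Measure.quasiMeasurePreserving_fst.ae h1,
    Measure.quasiMeasurePreserving_snd.ae hHc] with p hp1 hp2
  exact tendsto_leftStep_value hH hH2 (lt_of_le_of_ne p.1.2.1 hp1.symm) hp2

/-! ### Existence of the integral and moments of its increments -/

section Convergence

variable [IsProbabilityMeasure P]

/-- Joint measurability is inherited from the step processes, which converge almost everywhere. -/
lemma aestronglyMeasurable_uncurry_of_continuous (hH : ∀ t, Measurable[𝓕 t] (H t))
    (hH2 : ∀ t, MemLp (H t) 2 P) (hHc : ∀ᵐ ω ∂P, Continuous fun t ↦ H t ω) :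
    AEStronglyMeasurable (Function.uncurry H) ((volume : Measure (Set.Icc (0 : ℝ) 1)).prod P) :=
  aestronglyMeasurable_of_tendsto_ae atTop (fun n ↦ (leftStep hH hH2 n).memLp_value.1)
    (ae_tendsto_leftStep_value hH hH2 hHc)

lemma memLp_uncurry_of_continuous (hH : ∀ t, Measurable[𝓕 t] (H t))
    (hH2 : ∀ t, MemLp (H t) 2 P) (hHc : ∀ᵐ ω ∂P, Continuous fun t ↦ H t ω) {M : ℝ≥0∞}
    (hM : M ≠ ∞) (hMb : ∀ t, ∫⁻ ω, ‖H t ω‖ₑ ^ 2 ∂P ≤ M) :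
    MemLp (Function.uncurry H) 2 ((volume : Measure (Set.Icc (0 : ℝ) 1)).prod P) := by
  have hm := aestronglyMeasurable_uncurry_of_continuous hH hH2 hHc
  refine ⟨hm, ?_⟩
  rw [eLpNorm_lt_top_iff_lintegral_rpow_enorm_lt_top (by norm_num) (by norm_num)]
  simp only [ENNReal.toReal_ofNat, ENNReal.rpow_ofNat]
  rw [lintegral_prod _ (hm.enorm.pow_const 2)]
  refine lt_of_le_of_lt (lintegral_mono fun s ↦ hMb s) ?_
  simpa using hM.lt_top

/-- Vitali's theorem: convergence holds almost everywhere, and at each positive time a step process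
is a sampled value of `H`, so the fourth-moment bound carries over. -/
lemma tendsto_eLpNorm_leftStep_sub (hH : ∀ t, Measurable[𝓕 t] (H t))
    (hH2 : ∀ t, MemLp (H t) 2 P) (hHc : ∀ᵐ ω ∂P, Continuous fun t ↦ H t ω)
    (hL2 : MemLp (Function.uncurry H) 2 ((volume : Measure (Set.Icc (0 : ℝ) 1)).prod P))
    {M : ℝ≥0∞} (hM : M ≠ ∞) (hMb : ∀ t, ∫⁻ ω, ‖H t ω‖ₑ ^ 4 ∂P ≤ M) :
    Tendsto (fun n ↦ eLpNorm (fun p : Set.Icc (0 : ℝ) 1 × Ω ↦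
      (leftStep hH hH2 n).value p.1 p.2 - H p.1 p.2) 2 (volume.prod P)) atTop (𝓝 0) := by
  have hm : ∀ n, AEStronglyMeasurable (fun p : Set.Icc (0 : ℝ) 1 × Ω ↦
      (leftStep hH hH2 n).value p.1 p.2) (volume.prod P) := fun n ↦
    (leftStep hH hH2 n).memLp_value.1
  refine tendsto_Lp_finite_of_tendsto_ae (by norm_num) (by norm_num) hm hL2
    (unifIntegrable_two_of_lintegral_pow_four_le hm hM fun n ↦ ?_)
    (ae_tendsto_leftStep_value hH hH2 hHc)
  rw [lintegral_prod _ ((hm n).enorm.pow_const 4)]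
  calc ∫⁻ s, ∫⁻ ω, ‖(leftStep hH hH2 n).value s ω‖ₑ ^ 4 ∂P
      ≤ ∫⁻ _ : Set.Icc (0 : ℝ) 1, M := by
        refine lintegral_mono fun s ↦ ?_
        rcases (show (0 : Set.Icc (0 : ℝ) 1) ≤ s from s.2.1).eq_or_lt with rfl | hs
        · simp [leftStep_value_zero]
        · obtain ⟨u, -, hu⟩ := exists_leftStep_value_eq hH hH2 n hs
          simp only [hu]
          exact hMb u
    _ = M := by simp

/-- Existence of the Itô integral of an integrand that is a limit of simple processes. -/
lemma exists_isItoIntegral_of_tendsto (h𝓕 : IsBrownianFiltration 𝓕 W P)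
    (hW : IsStandardBrownianMotion W P)
    (hL2 : MemLp (Function.uncurry H) 2 ((volume : Measure (Set.Icc (0 : ℝ) 1)).prod P))
    {V : ℕ → SimpleProcess 𝓕 P}
    (hV : Tendsto (fun n ↦ eLpNorm (fun p : Set.Icc (0 : ℝ) 1 × Ω ↦
      (V n).value p.1 p.2 - H p.1 p.2) 2 (volume.prod P)) atTop (𝓝 0)) :
    ∃ Z, IsItoIntegral 𝓕 P W H Z := by
  have h12 : Fact ((1 : ℝ≥0∞) ≤ 2) := ⟨by norm_num⟩
  have hcauchy : CauchySeq fun n ↦ (V n).memLp_value.toLp :=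
    ((Lp.tendsto_Lp_iff_tendsto_eLpNorm'' _ (fun n ↦ (V n).memLp_value) _ hL2).2 hV).cauchySeq
  have hlim : ∀ t, ∃ Z : Ω → ℝ, Measurable Z ∧
      Tendsto (fun n ↦ eLpNorm (fun ω ↦ (V n).integral W t ω - Z ω) 2 P) atTop (𝓝 0) := by
    intro t
    have hI := fun n ↦ (V n).memLp_integral h𝓕 hW t
    have hc : CauchySeq fun n ↦ (hI n).toLp := by
      rw [EMetric.cauchySeq_iff] at hcauchy ⊢
      intro ε hε
      obtain ⟨N, hN⟩ := hcauchy ε hε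
      refine ⟨N, fun m hm n hn ↦ lt_of_le_of_lt ?_ (hN m hm n hn)⟩
      rw [Lp.edist_toLp_toLp, Lp.edist_toLp_toLp]
      exact (V m).eLpNorm_integral_sub_le h𝓕 hW (V n) t
    obtain ⟨z, hz⟩ := cauchySeq_tendsto_of_complete hc
    refine ⟨z, (Lp.stronglyMeasurable z).measurable, ?_⟩
    have hz' := (Lp.tendsto_Lp_iff_tendsto_eLpNorm' _ _).1 hz
    refine hz'.congr fun n ↦ eLpNorm_congr_ae ?_
    filter_upwards [(hI n).coeFn_toLp] with ω hω
    simp [hω]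
  choose Z hZm hZ using hlim
  exact ⟨Z, hL2, hZm, V, hV, hZ⟩

/-- The Itô integral does not depend on the approximating simple processes. -/
lemma IsItoIntegral.tendsto_integral (h𝓕 : IsBrownianFiltration 𝓕 W P)
    (hW : IsStandardBrownianMotion W P) {Z : Set.Icc (0 : ℝ) 1 → Ω → ℝ}
    (hZ : IsItoIntegral 𝓕 P W H Z) {V : ℕ → SimpleProcess 𝓕 P}
    (hV : Tendsto (fun n ↦ eLpNorm (fun p : Set.Icc (0 : ℝ) 1 × Ω ↦
      (V n).value p.1 p.2 - H p.1 p.2) 2 (volume.prod P)) atTop (𝓝 0)) (t : Set.Icc (0 : ℝ) 1) :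
    Tendsto (fun n ↦ eLpNorm (fun ω ↦ (V n).integral W t ω - Z t ω) 2 P) atTop (𝓝 0) := by
  obtain ⟨U, hU, hUZ⟩ := hZ.approx
  have hsum := (hV.add hU).add (hUZ t)
  rw [add_zero, add_zero] at hsum
  refine tendsto_of_tendsto_of_tendsto_of_le_of_le tendsto_const_nhds hsum (fun _ ↦ zero_le)
    fun n ↦ ?_
  have hIV := ((V n).memLp_integral h𝓕 hW t).1
  have hIU := ((U n).memLp_integral h𝓕 hW t).1
  have hVm := (V n).memLp_value.1
  have hUm := (U n).memLp_value.1
  have hHm : AEStronglyMeasurable (fun p : Set.Icc (0 : ℝ) 1 × Ω ↦ H p.1 p.2) (volume.prod P) :=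
    hZ.integrand_memLp.1
  have h1 : eLpNorm (fun ω ↦ (V n).integral W t ω - Z t ω) 2 P ≤
      eLpNorm (fun ω ↦ (V n).integral W t ω - (U n).integral W t ω) 2 P +
      eLpNorm (fun ω ↦ (U n).integral W t ω - Z t ω) 2 P := by
    refine le_of_eq_of_le ?_ (eLpNorm_add_le (hIV.sub hIU)
      (hIU.sub (hZ.measurable t).aestronglyMeasurable) (by norm_num))
    congr 1
    ext ω
    simp
  have h2 : eLpNorm (fun p : Set.Icc (0 : ℝ) 1 × Ω ↦ (V n).value p.1 p.2 - (U n).value p.1 p.2) 2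
      (volume.prod P) ≤
      eLpNorm (fun p : Set.Icc (0 : ℝ) 1 × Ω ↦ (V n).value p.1 p.2 - H p.1 p.2) 2
        (volume.prod P) +
      eLpNorm (fun p : Set.Icc (0 : ℝ) 1 × Ω ↦ (U n).value p.1 p.2 - H p.1 p.2) 2
        (volume.prod P) := by
    refine le_of_eq_of_le ?_ (eLpNorm_sub_le (hVm.sub hHm) (hUm.sub hHm) (by norm_num))
    congr 1
    ext p
    simp
  refine h1.trans ?_
  gcongr
  exact ((V n).eLpNorm_integral_sub_le h𝓕 hW (U n) t).trans h2

/-- Clamping the grid to `[s, t]` turns the increment into a sum of Brownian increments with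
coefficients independent of `W`. The resulting bound does not depend on the mesh, as the later limit
requires. -/
lemma lintegral_leftStep_integral_sub_pow_le (hH : ∀ t, Measurable[𝓕 t] (H t))
    (hH2 : ∀ t, MemLp (H t) 2 P) (hW : IsStandardBrownianMotion W P)
    (hHW : IndepFun (fun ω t ↦ H t ω) (fun ω t ↦ W t ω) P) {p : ℕ} (hp : 0 < p) {M : ℝ≥0∞}
    (hM : ∀ t, ∫⁻ ω, ‖H t ω‖ₑ ^ (2 * p) ∂P ≤ M) (n : ℕ) {s t : Set.Icc (0 : ℝ) 1} (hst : s ≤ t) :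
    ∫⁻ ω, ‖(leftStep hH hH2 n).integral W t ω - (leftStep hH hH2 n).integral W s ω‖ₑ ^ (2 * p) ∂P ≤
      (∫⁻ x, ‖x‖ₑ ^ (2 * p) ∂(gaussianReal 0 1)) * M * ENNReal.ofReal ((t : ℝ) - s) ^ p := by
  set τ : Fin (n + 1 + 1) → Set.Icc (0 : ℝ) 1 := fun k ↦ max s (min (gridPoint n k) t) with hτ
  have hτm : Monotone τ := fun k l h ↦
    max_le_max le_rfl (min_le_min (gridPoint_mono n (Fin.le_def.1 h)) le_rfl)
  have e : ∀ ω, (leftStep hH hH2 n).integral W t ω - (leftStep hH hH2 n).integral W s ω =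
      ∑ i : Fin (n + 1), H (gridPoint n i) ω * (W (τ i.succ) ω - W (τ i.castSucc) ω) := by
    intro ω
    have hI : ∀ r, (leftStep hH hH2 n).integral W r ω = ∑ i : Fin (n + 1), H (gridPoint n i) ω *
        (W (min (gridPoint n i.succ) r) ω - W (min (gridPoint n i.castSucc) r) ω) := fun _ ↦ rfl
    rw [hI, hI, ← Finset.sum_sub_distrib]
    refine Finset.sum_congr rfl fun i _ ↦ ?_
    have h1 := sub_min_eq_sub_clamp (fun r ↦ W r ω) hst (gridPoint n i.succ)
    have h2 := sub_min_eq_sub_clamp (fun r ↦ W r ω) hst (gridPoint n i.castSucc)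
    rw [← mul_sub]
    congr 1
    simp only [hτ]
    linarith
  simp_rw [e]
  have hAW : IndepFun (fun ω (i : Fin (n + 1)) ↦ H (gridPoint n i) ω) (fun ω t ↦ W t ω) P :=
    hHW.comp (φ := fun (x : Set.Icc (0 : ℝ) 1 → ℝ) (i : Fin (n + 1)) ↦ x (gridPoint n i))
      (ψ := id) (by fun_prop) measurable_id
  refine (hW.lintegral_sum_mul_increments_pow_le hτm
    (fun i ↦ (hH _).mono (𝓕.le _) le_rfl) hAW hp (fun i ↦ hM _)).trans ?_
  refine mul_le_mul' le_rfl (pow_le_pow_left' (ENNReal.ofReal_le_ofReal ?_) p)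
  have h1 : τ (Fin.last (n + 1)) ≤ t := max_le hst (min_le_right _ _)
  have h0 : s ≤ τ 0 := le_max_left _ _
  have h1' : (τ (Fin.last (n + 1)) : ℝ) ≤ t := h1
  have h0' : (s : ℝ) ≤ τ 0 := h0
  linarith

/-- Moment bounds for the increments of an Itô integral whose integrand is independent of the
Brownian motion. -/
lemma IsItoIntegral.lintegral_sub_pow_le (h𝓕 : IsBrownianFiltration 𝓕 W P)
    (hH : ∀ t, Measurable[𝓕 t] (H t))
    (hH2 : ∀ t, MemLp (H t) 2 P) (hW : IsStandardBrownianMotion W P)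
    (hHW : IndepFun (fun ω t ↦ H t ω) (fun ω t ↦ W t ω) P)
    {Z : Set.Icc (0 : ℝ) 1 → Ω → ℝ} (hZ : IsItoIntegral 𝓕 P W H Z)
    (hV : Tendsto (fun n ↦ eLpNorm (fun p : Set.Icc (0 : ℝ) 1 × Ω ↦
      (leftStep hH hH2 n).value p.1 p.2 - H p.1 p.2) 2 (volume.prod P)) atTop (𝓝 0))
    {p : ℕ} (hp : 0 < p) {M : ℝ≥0∞}
    (hM : ∀ t, ∫⁻ ω, ‖H t ω‖ₑ ^ (2 * p) ∂P ≤ M) (s t : Set.Icc (0 : ℝ) 1) :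
    ∫⁻ ω, ‖Z t ω - Z s ω‖ₑ ^ (2 * p) ∂P ≤
      (∫⁻ x, ‖x‖ₑ ^ (2 * p) ∂(gaussianReal 0 1)) * M * ENNReal.ofReal |(t : ℝ) - s| ^ p := by
  wlog hst : s ≤ t generalizing s t
  · have h := this t s (le_of_not_ge hst)
    rw [abs_sub_comm] at h
    simpa only [enorm_sub_rev] using h
  set V := leftStep hH hH2
  have hconv : ∀ r, TendstoInMeasure P (fun n ↦ (V n).integral W r) atTop (Z r) := fun r ↦
    tendstoInMeasure_of_tendsto_eLpNorm (p := 2) (by norm_num)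
      (fun n ↦ ((V n).memLp_integral h𝓕 hW r).1) (hZ.measurable r).aestronglyMeasurable
      (hZ.tendsto_integral h𝓕 hW hV r)
  obtain ⟨ns, hns, hlim⟩ := (hconv t).exists_seq_tendsto_ae
  -- The second subsequence is extracted from the first, so almost sure convergence at `s` and `t`
  -- holds along common indices.
  obtain ⟨ms, hms, hlim'⟩ := ((hconv s).comp hns.tendsto_atTop).exists_seq_tendsto_ae
  have hst' : (s : ℝ) ≤ t := hst
  rw [abs_of_nonneg (by linarith)]
  have hVm : ∀ n r, Measurable ((V n).integral W r) := fun n r ↦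
    Finset.measurable_sum _ fun i _ ↦
      (((V n).coeff_measurable i).mono (𝓕.le _) le_rfl).mul
        ((hW.measurable _).sub (hW.measurable _))
  have hcongr : ∫⁻ ω, ‖Z t ω - Z s ω‖ₑ ^ (2 * p) ∂P = ∫⁻ ω, liminf (fun n ↦
      ‖(V (ns (ms n))).integral W t ω - (V (ns (ms n))).integral W s ω‖ₑ ^ (2 * p)) atTop ∂P := by
    refine lintegral_congr_ae ?_
    filter_upwards [hlim, hlim'] with ω h1 h2
    have h3 := (h1.comp hms.tendsto_atTop).sub h2
    exact (((ENNReal.continuous_pow (2 * p)).comp continuous_enorm).tendsto _ |>.comp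
      h3).liminf_eq.symm
  rw [hcongr]
  -- Fatou's lemma carries the uniform bound to the limit without any convergence of higher moments.
  refine (lintegral_liminf_le fun n ↦ ((hVm _ t).sub (hVm _ s)).enorm.pow_const _).trans ?_
  refine (liminf_le_liminf (.of_forall fun n ↦
    lintegral_leftStep_integral_sub_pow_le hH hH2 hW hHW hp hM (ns (ms n)) hst)).trans ?_
  rw [liminf_const]

end Convergence

end StepProcess

/-! ### The main theorem -/

theorem theorem1 {Ω : Type*} {mΩ : MeasurableSpace Ω} (P : Measure Ω) [IsProbabilityMeasure P]
    (X W : Set.Icc (0 : ℝ) 1 → Ω → ℝ) (Φ : ℝ → ℝ) (α : ℝ)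
    -- `X` is a centered Gaussian process with almost surely `α`-Hölder paths, `α ∈ (1/2, 1]`
    (hX : ∀ t, Measurable (X t))
    (hX_gauss : IsGaussianProcess X P)
    (hX_centered : ∀ t, ∫ ω, X t ω ∂P = 0)
    (hα : α ∈ Set.Ioc (1 / 2 : ℝ) 1)
    (hX_holder : ∀ᵐ ω ∂P, ∃ C : ℝ, ∀ s₁ s₂ : Set.Icc (0 : ℝ) 1,
      |X s₁ ω - X s₂ ω| ≤ C * |(s₁ : ℝ) - (s₂ : ℝ)| ^ α)
    -- `Φ` is `C¹` and grows, together with its derivative, at most polynomially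
    (hΦ : ContDiff ℝ 1 Φ)
    (hΦ_growth : ∃ c L : ℝ, 0 < c ∧ 0 < L ∧ ∀ x, |Φ x| + |deriv Φ x| ≤ c * (1 + |x|) ^ L)
    -- `W` is a standard Brownian motion independent of `X`
    (hW : IsStandardBrownianMotion W P)
    (hXW : IndepFun (fun ω t ↦ X t ω) (fun ω t ↦ W t ω) P) :
    -- the stochastic integral `Z t = ∫₀ᵗ Φ(X s) dW s` is well defined
    (∃ Z : Set.Icc (0 : ℝ) 1 → Ω → ℝ,
      IsItoIntegral (jointFiltration X W hX hW.measurable) P W (fun s ω ↦ Φ (X s ω)) Z) ∧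
    -- and it has a modification whose paths are almost surely in `C^γ([0,1])` for all `γ < 1/2`
    ∀ Z : Set.Icc (0 : ℝ) 1 → Ω → ℝ,
      IsItoIntegral (jointFiltration X W hX hW.measurable) P W (fun s ω ↦ Φ (X s ω)) Z →
      ∃ Y : Set.Icc (0 : ℝ) 1 → Ω → ℝ, IsModification P Y Z ∧
        ∀ᵐ ω ∂P, ∀ γ ∈ Set.Ico (0 : ℝ) (1 / 2), (fun t ↦ Y t ω) ∈ holderSpace γ := by
  obtain ⟨c, L, -, -, hgrowth⟩ := hΦ_growth
  have hX_cont : ∀ᵐ ω ∂P, Continuous fun t ↦ X t ω := by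
    filter_upwards [hX_holder] with ω ⟨C, hC⟩
    have hα0 : 0 < α := by linarith [hα.1]
    refine (mem_holderSpace_of_abs_sub_le (C := C) hα0 le_rfl fun s t hst ↦ ?_).1
    have hst' : (s : ℝ) ≤ t := hst
    have h := hC t s
    rwa [abs_of_nonneg (a := (t : ℝ) - s) (by linarith)] at h
  obtain ⟨B, hB⟩ := exists_hasLaw_gaussianReal_le hX hX_gauss hX_centered hX_cont
  have hmom := exists_lintegral_comp_pow_le hB hΦ.continuous.measurable (c := c) (L := L)
    fun x ↦ (le_add_of_nonneg_right (abs_nonneg _)).trans (hgrowth x)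
  set 𝓕 := jointFiltration X W hX hW.measurable
  have h𝓕 : IsBrownianFiltration 𝓕 W P :=
    ⟨measurable_jointFiltration_right hX hW.measurable, fun u v huv f hf ↦
      indepFun_increment_of_measurable_jointFiltration hX hW hXW huv hf⟩
  have hH : ∀ t, Measurable[𝓕 t] fun ω ↦ Φ (X t ω) := fun t ↦
    hΦ.continuous.measurable.comp (measurable_jointFiltration_left hX hW.measurable t)
  have hHc : ∀ᵐ ω ∂P, Continuous fun t ↦ Φ (X t ω) := by
    filter_upwards [hX_cont] with ω hω using hΦ.continuous.comp hω
  have hHW : IndepFun (fun ω t ↦ Φ (X t ω)) (fun ω t ↦ W t ω) P :=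
    hXW.comp (φ := fun (x : Set.Icc (0 : ℝ) 1 → ℝ) t ↦ Φ (x t)) (ψ := id)
      (measurable_pi_lambda _ fun t ↦ hΦ.continuous.measurable.comp (measurable_pi_apply t))
      measurable_id
  -- Second moments put the integrand in `L²`; fourth moments give the uniform integrability behind
  -- convergence of the step processes.
  obtain ⟨M₂, hM₂, hM₂b⟩ := hmom 2
  obtain ⟨M₄, hM₄, hM₄b⟩ := hmom 4
  have hH2 : ∀ t, MemLp (fun ω ↦ Φ (X t ω)) 2 P := by
    intro t
    refine ⟨(hΦ.continuous.measurable.comp (hX t)).aestronglyMeasurable, ?_⟩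
    rw [eLpNorm_lt_top_iff_lintegral_rpow_enorm_lt_top (by norm_num) (by norm_num)]
    simp only [ENNReal.toReal_ofNat, ENNReal.rpow_ofNat]
    exact (hM₂b t).trans_lt hM₂.lt_top
  have hL2 := memLp_uncurry_of_continuous hH hH2 hHc hM₂ hM₂b
  have hV := tendsto_eLpNorm_leftStep_sub hH hH2 hHc hL2 hM₄ hM₄b
  refine ⟨exists_isItoIntegral_of_tendsto h𝓕 hW hL2 hV, fun Z hZ ↦
    exists_modification_holder hZ.measurable fun p hp ↦ ?_⟩
  obtain ⟨M, hM, hMb⟩ := hmom (2 * p)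
  exact ⟨_, ENNReal.mul_ne_top (lintegral_enorm_pow_gaussianReal_ne_top (2 * p)) hM,
    hZ.lintegral_sub_pow_le h𝓕 hH hH2 hW hHW hV hp hMb⟩
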